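/- Let $\rho\neq 0$ and $\sigma$ be non-negative (positive semidefinite) operators on a finite-dimensional complex Hilbert space. For $\alpha\in(0,1)\cup(1,\infty)$ put $$\bar Q_\alpha(\rho\|\sigma)=\operatorname{tr}\rho^{\alpha}\sigma^{1-\alpha},\qquad \tilde Q_\alpha(\rho\|\sigma)=\operatorname{tr}\big(\sigma^{\frac{1-\alpha}{2\alpha}}\rho\,\sigma^{\frac{1-\alpha}{2\alpha}}\big)^{\alpha},$$ where negative powers are generalized inverses. The Petz divergence $\bar D_\alpha(\rho\|\sigma)$ and the minimal (sandwiched) divergence $\tilde D_\alpha(\rho\|\sigma)$, with values in the extended reals, are $$\frac{1}{\alpha-1}\log\frac{Q_\alpha(\rho\|\sigma)}{\operatorname{tr}\rho}\quad\text{if }\alpha<1\text{ or }\ker\sigma\subseteq\ker\rho,\qquad \infty\quad\text{otherwise},$$ with $Q_\alpha=\bar Q_\alpha$ and $Q_\alpha=\tilde Q_\alpha$ respectively, and $\log 0=-\infty$. For $\alpha=0$ and $\alpha=1$ they are defined as the limits as $\alpha\to0^+$ and $\alpha\to1$ (from both sides). Then these limits exist in $[-\infty,\infty]$, and for every $\alpha\in[0,1]$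 (with $0\cdot\infty=0$) $$\alpha\,\bar D_\alpha(\rho\|\sigma)+(1-\alpha)\,(\log\operatorname{tr}\rho-\log\operatorname{tr}\sigma)\;\le\;\tilde D_\alpha(\rho\|\sigma)\;\le\;\bar D_\alpha(\rho\|\sigma).$$ In particular, if $\operatorname{tr}\rho=\operatorname{tr}\sigma=1$, then $\alpha\,\bar D_\alpha(\rho\|\sigma)\le\tilde D_\alpha(\rho\|\sigma)\le\bar D_\alpha(\rho\|\sigma)$ for every $\alpha\in[0,1]$. -/

import Mathlib

open Filter Topology Matrix
open scoped ComplexOrder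

noncomputable section

namespace QDiv

variable {n : Type*} [Fintype n] [DecidableEq n]

/-- The real power `A ^ s` of a Hermitian matrix, by functional calculus: if `A = ∑ᵢ λᵢ Pᵢ`
then `A ^ s = ∑ᵢ λᵢ ^ s Pᵢ`. As `(0 : ℝ) ^ s = 0` for every `s ≠ 0`, negative powers of
non-negative matrices are generalized inverses (inverses on the support). Every function is
continuous on the (finite) spectrum of a matrix, so `cfc` never takes a default value on
Hermitian matrices. -/
def mpow (A : Matrix n n ℂ) (s : ℝ) : Matrix n n ℂ :=
  cfc (fun x : ℝ => x ^ s) A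

/-- The real part of the trace; all traces below are real and non-negative. -/
def rtr (A : Matrix n n ℂ) : ℝ := (Matrix.trace A).re

/-- The logarithm on `[0, ∞)` with `log 0 = -∞`. -/
def elog (x : ℝ) : EReal := ENNReal.log (ENNReal.ofReal x)

/-- `σ ≫ ρ`: the kernel of `σ` is contained in the kernel of `ρ`. -/
def Dominates (σ ρ : Matrix n n ℂ) : Prop :=
  ∀ v : n → ℂ, σ *ᵥ v = 0 → ρ *ᵥ v = 0

/-- `Q̄_α(ρ‖σ) = tr ρ^α σ^(1-α)`. -/
def petzQ (α : ℝ) (ρ σ : Matrix n n ℂ) : ℝ :=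
  rtr (mpow ρ α * mpow σ (1 - α))

/-- `Q̃_α(ρ‖σ) = tr (σ^((1-α)/(2α)) ρ σ^((1-α)/(2α)))^α`. -/
def minimalQ (α : ℝ) (ρ σ : Matrix n n ℂ) : ℝ :=
  rtr (mpow (mpow σ ((1 - α) / (2 * α)) * ρ * mpow σ ((1 - α) / (2 * α))) α)

open Classical in
/-- The Petz divergence for `α ∈ (0,1) ∪ (1,∞)`. -/
def petzAux (ρ σ : Matrix n n ℂ) (α : ℝ) : EReal :=
  if Dominates σ ρ ∨ α < 1 then
    ((1 / (α - 1) : ℝ) : EReal) * elog (1 / rtr ρ * petzQ α ρ σ)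
  else ⊤

open Classical in
/-- The minimal (sandwiched) divergence for `α ∈ (0,1) ∪ (1,∞)`. -/
def minimalAux (ρ σ : Matrix n n ℂ) (α : ℝ) : EReal :=
  if Dominates σ ρ ∨ α < 1 then
    ((1 / (α - 1) : ℝ) : EReal) * elog (1 / rtr ρ * minimalQ α ρ σ)
  else ⊤

/-- The Petz quantum Rényi divergence `D̄_α(ρ‖σ)`, `α ∈ [0,∞)`; the values at `α = 0` and
`α = 1` are limits in the extended reals (from the right at `0`, two-sided at `1`). -/
def petzDiv (α : ℝ) (ρ σ : Matrix n n ℂ) : EReal :=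
  if α = 0 then limUnder (𝓝[>] (0 : ℝ)) (petzAux ρ σ)
  else if α = 1 then limUnder (𝓝[≠] (1 : ℝ)) (petzAux ρ σ)
  else petzAux ρ σ α

/-- The minimal quantum Rényi divergence `D̃_α(ρ‖σ)`, `α ∈ [0,∞)`; the values at `α = 0` and
`α = 1` are limits in the extended reals (from the right at `0`, two-sided at `1`). -/
def minimalDiv (α : ℝ) (ρ σ : Matrix n n ℂ) : EReal :=
  if α = 0 then limUnder (𝓝[>] (0 : ℝ)) (minimalAux ρ σ)
  else if α = 1 then limUnder (𝓝[≠] (1 : ℝ)) (minimalAux ρ σ)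
  else minimalAux ρ σ α

end QDiv

end

/-! For 0 < α < 1 everything reduces to comparing the two traces `petzQ` and `minimalQ`, since
dividing their logarithms by α - 1 < 0 reverses inequalities. The Araki–Lieb–Thirring inequality
(`rtr_mpow_conj_le`) gives `petzQ` ≤ `minimalQ`, which is the upper bound. The lower bound is a
converse obtained from Hölder's inequality (`rtr_mpow_mul_mul_le`): σ^((1-α)/(2α)) ρ^(1/2) is a
power of σ, times σ^((1-α)/2) ρ^(α/2), times a power of ρ.

Both trace inequalities rest on log-majorization. The norm of the k-th compound matrix is the
product of the k largest eigenvalues, and compounds respect products and powers. An operator norm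
inequality (Cordes, or submultiplicativity) applied to compounds therefore compares these products,
and such a comparison passes to sums of powers.

At α = 1 with ker σ ⊆ ker ρ, the Petz limit is the derivative of a differentiable function and the
minimal divergence is squeezed to it; to the right of 1 this uses the analogous inequalities for 1 <
α < 2. Without the inclusion both limits are infinite. At α = 0, `petzQ` has a continuous extension,
while `minimalQ` converges because, with t = (1-α)/α and ρ scaled to a contraction, the trace of
(σ^(t/2) ρ σ^(t/2))^(1/t) is increasing and bounded. -/

set_option linter.unusedSectionVars false

noncomputable section

namespace QDiv

open scoped MatrixOrder Matrix.Norms.L2Operator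

variable {n : Type*} [Fintype n] [DecidableEq n]

/-! ### Functional calculus by unitary diagonalization -/

/-- The matrix `U * diag d * Uᴴ`. -/
def conjDiag (U : Matrix n n ℂ) (d : n → ℝ) : Matrix n n ℂ :=
  U * diagonal (fun i => (d i : ℂ)) * Uᴴ

lemma conjDiag_isHermitian (U : Matrix n n ℂ) (d : n → ℝ) : (conjDiag U d).IsHermitian := by
  have : (diagonal (fun i => (d i : ℂ))).IsHermitian := by
    rw [Matrix.IsHermitian, diagonal_conjTranspose]
    congr 1
    ext i
    simp
  exact isHermitian_mul_mul_conjTranspose U this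

lemma conjDiag_posSemidef (U : Matrix n n ℂ) {d : n → ℝ} (hd : ∀ i, 0 ≤ d i) :
    (conjDiag U d).PosSemidef := by
  have : (diagonal (fun i => (d i : ℂ))).PosSemidef :=
    PosSemidef.diagonal fun i => Complex.zero_le_real.2 (hd i)
  exact this.mul_mul_conjTranspose_same U

lemma conjDiag_mul {U : Matrix n n ℂ} (hU : Uᴴ * U = 1) (d e : n → ℝ) :
    conjDiag U d * conjDiag U e = conjDiag U (fun i => d i * e i) := by
  have : conjDiag U d * conjDiag U e
      = U * (diagonal (fun i => (d i : ℂ)) * (Uᴴ * U) * diagonal (fun i => (e i : ℂ))) * Uᴴ := by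
    simp only [conjDiag, Matrix.mul_assoc]
  rw [this, hU, Matrix.mul_one, diagonal_mul_diagonal]
  simp [conjDiag]

lemma conjDiag_add (U : Matrix n n ℂ) (d e : n → ℝ) :
    conjDiag U d + conjDiag U e = conjDiag U (fun i => d i + e i) := by
  simp only [conjDiag, ← Matrix.add_mul, ← Matrix.mul_add, diagonal_add]
  simp

lemma conjDiag_smul (U : Matrix n n ℂ) (c : ℝ) (d : n → ℝ) :
    c • conjDiag U d = conjDiag U (fun i => c * d i) := by
  have : diagonal (fun i => ((c * d i : ℝ) : ℂ)) = c • diagonal (fun i => (d i : ℂ)) := by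
    rw [← diagonal_smul]
    congr 1
    ext i
    simp
  simp only [conjDiag, this, Matrix.mul_smul, Matrix.smul_mul]

lemma conjDiag_const {U : Matrix n n ℂ} (hU : U * Uᴴ = 1) (c : ℝ) :
    conjDiag U (fun _ => c) = c • 1 := by
  have : conjDiag U (fun _ => c) = c • conjDiag U (fun _ => 1) := by
    rw [conjDiag_smul]; simp
  rw [this]
  simp [conjDiag, hU]

lemma rtr_conjDiag {U : Matrix n n ℂ} (hU : Uᴴ * U = 1) (d : n → ℝ) :
    rtr (conjDiag U d) = ∑ i, d i := by
  rw [rtr, conjDiag, trace_mul_comm, ← Matrix.mul_assoc, hU, Matrix.one_mul, trace_diagonal]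
  simp

lemma aeval_conjDiag {U : Matrix n n ℂ} (hU : Uᴴ * U = 1) (hU' : U * Uᴴ = 1) (d : n → ℝ)
    (q : Polynomial ℝ) :
    Polynomial.aeval (conjDiag U d) q = conjDiag U (fun i => q.eval (d i)) := by
  induction q using Polynomial.induction_on' with
  | add p q hp hq => simp [hp, hq, conjDiag_add]
  | monomial k a =>
    rw [Polynomial.aeval_monomial, Algebra.algebraMap_eq_smul_one, smul_mul_assoc, one_mul]
    have : conjDiag U d ^ k = conjDiag U (fun i => d i ^ k) := by
      induction k with
      | zero => simp [conjDiag_const hU']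
      | succ k ih => rw [pow_succ, ih, conjDiag_mul hU]; simp [pow_succ]
    rw [this, conjDiag_smul]
    simp

/-- Lagrange interpolation replaces `f` by a polynomial. The nodes include both the spectrum and the
values of `d`, so the two need not be identified with each other. -/
lemma cfc_conjDiag {U : Matrix n n ℂ} (hU : Uᴴ * U = 1) (hU' : U * Uᴴ = 1) (d : n → ℝ)
    (f : ℝ → ℝ) : cfc f (conjDiag U d) = conjDiag U (fun i => f (d i)) := by
  classical
  have hH := conjDiag_isHermitian U d
  let S : Finset ℝ := (conjDiag U d).finite_real_spectrum.toFinset ∪ Finset.univ.image d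
  let q := Lagrange.interpolate S id f
  have hq : ∀ x ∈ S, q.eval x = f x := fun x hx =>
    Lagrange.eval_interpolate_at_node (v := id) f Function.injective_id.injOn hx
  have h1 : cfc f (conjDiag U d) = cfc (fun x => q.eval x) (conjDiag U d) := by
    apply cfc_congr
    intro x hx
    exact (hq x (Finset.mem_union_left _ (by simpa using hx))).symm
  rw [h1, cfc_polynomial q _ hH.isSelfAdjoint, aeval_conjDiag hU hU']
  congr 1
  ext i
  exact hq _ (Finset.mem_union_right _ (by simp))

lemma mpow_conjDiag {U : Matrix n n ℂ} (hU : Uᴴ * U = 1) (hU' : U * Uᴴ = 1) (d : n → ℝ)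
    (s : ℝ) : mpow (conjDiag U d) s = conjDiag U (fun i => d i ^ s) :=
  cfc_conjDiag hU hU' d _

lemma exists_conjDiag {A : Matrix n n ℂ} (hA : A.PosSemidef) :
    ∃ U : Matrix n n ℂ, Uᴴ * U = 1 ∧ U * Uᴴ = 1 ∧
      A = conjDiag U hA.isHermitian.eigenvalues ∧ ∀ i, 0 ≤ hA.isHermitian.eigenvalues i := by
  refine ⟨hA.isHermitian.eigenvectorUnitary, ?_, ?_, ?_, hA.eigenvalues_nonneg⟩
  · exact Unitary.coe_star_mul_self _
  · exact Unitary.coe_mul_star_self _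
  · exact hA.isHermitian.spectral_theorem

lemma mpow_posSemidef {A : Matrix n n ℂ} (hA : A.PosSemidef) (s : ℝ) : (mpow A s).PosSemidef := by
  obtain ⟨U, h1, h2, h3, h4⟩ := exists_conjDiag hA
  rw [h3, mpow_conjDiag h1 h2]
  exact conjDiag_posSemidef _ fun i => Real.rpow_nonneg (h4 i) _

lemma mpow_one {A : Matrix n n ℂ} (hA : A.PosSemidef) : mpow A 1 = A := by
  obtain ⟨U, h1, h2, h3, h4⟩ := exists_conjDiag hA
  rw [h3, mpow_conjDiag h1 h2]
  simp

/-- The case s + t = 0 must be excluded: for s ≠ 0 the product is the support projection, whereas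
`mpow A 0` is the identity because 0 ^ 0 = 1. -/
lemma mpow_mul_mpow {A : Matrix n n ℂ} (hA : A.PosSemidef) {s t : ℝ} (h : s + t ≠ 0) :
    mpow A s * mpow A t = mpow A (s + t) := by
  obtain ⟨U, h1, h2, h3, h4⟩ := exists_conjDiag hA
  rw [h3]
  simp only [mpow_conjDiag h1 h2, conjDiag_mul h1]
  congr 1
  ext i
  rw [Real.rpow_add' (h4 i) h]

lemma mpow_mpow {A : Matrix n n ℂ} (hA : A.PosSemidef) (s t : ℝ) :
    mpow (mpow A s) t = mpow A (s * t) := by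
  obtain ⟨U, h1, h2, h3, h4⟩ := exists_conjDiag hA
  rw [h3]
  simp only [mpow_conjDiag h1 h2]
  congr 1
  ext i
  rw [Real.rpow_mul (h4 i)]

lemma mpow_smul {A : Matrix n n ℂ} (hA : A.PosSemidef) {c : ℝ} (hc : 0 ≤ c) (s : ℝ) :
    mpow (c • A) s = c ^ s • mpow A s := by
  obtain ⟨U, h1, h2, h3, h4⟩ := exists_conjDiag hA
  rw [h3]
  simp only [mpow_conjDiag h1 h2, conjDiag_smul]
  congr 1
  ext i
  rw [Real.mul_rpow hc (h4 i)]

lemma rtr_mpow {A : Matrix n n ℂ} (hA : A.PosSemidef) (s : ℝ) :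
    rtr (mpow A s) = ∑ i, hA.isHermitian.eigenvalues i ^ s := by
  obtain ⟨U, h1, h2, h3, h4⟩ := exists_conjDiag hA
  conv_lhs => rw [h3]
  rw [mpow_conjDiag h1 h2, rtr_conjDiag h1]

lemma rtr_mul_comm (A B : Matrix n n ℂ) : rtr (A * B) = rtr (B * A) := by
  rw [rtr, rtr, trace_mul_comm]

lemma rtr_smul (c : ℝ) (A : Matrix n n ℂ) : rtr (c • A) = c * rtr A := by
  simp [rtr, trace_smul]

lemma rtr_nonneg {A : Matrix n n ℂ} (hA : A.PosSemidef) : 0 ≤ rtr A :=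
  (Complex.le_def.1 hA.trace_nonneg).1

lemma rtr_mono {A B : Matrix n n ℂ} (h : A ≤ B) : rtr A ≤ rtr B := by
  have := rtr_nonneg (Matrix.le_iff.1 h)
  simp only [rtr, trace_sub, Complex.sub_re] at this ⊢
  linarith

lemma rtr_eq_zero {A : Matrix n n ℂ} (hA : A.PosSemidef) (h : rtr A = 0) : A = 0 := by
  apply hA.trace_eq_zero_iff.1
  apply Complex.ext h
  exact (Complex.le_def.1 hA.trace_nonneg).2.symm

lemma mpow_eq_rpow {A : Matrix n n ℂ} (hA : A.PosSemidef) (s : ℝ) : mpow A s = A ^ s := by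
  have h0 : 0 ≤ A := nonneg_iff_posSemidef.2 hA
  rw [CFC.rpow_eq_cfc_real h0]
  rfl

/-- The Löwner–Heinz inequality. -/
lemma mpow_le_mpow {A B : Matrix n n ℂ} (hA : A.PosSemidef) (h : A ≤ B) {s : ℝ} (hs : 0 ≤ s)
    (hs1 : s ≤ 1) : mpow A s ≤ mpow B s := by
  have hB : B.PosSemidef := nonneg_iff_posSemidef.1 ((nonneg_iff_posSemidef.2 hA).trans h)
  rw [mpow_eq_rpow hA, mpow_eq_rpow hB]
  exact CFC.rpow_le_rpow ⟨hs, hs1⟩ h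

/-! ### The Cordes inequality -/

lemma norm_mul_self_eq {A B : Matrix n n ℂ} (hA : A.PosSemidef) (hB : B.PosSemidef) :
    ‖B * (A * A) * B‖ = ‖A * B‖ ^ 2 := by
  have : B * (A * A) * B = star (A * B) * (A * B) := by
    rw [star_mul, star_eq_conjTranspose, star_eq_conjTranspose, hA.isHermitian.eq,
      hB.isHermitian.eq]
    simp only [Matrix.mul_assoc]
  rw [this, CStarRing.norm_star_mul_self, sq]

lemma posSemidef_conj_sq {A B : Matrix n n ℂ} (hA : A.PosSemidef) (hB : B.PosSemidef) :
    (B * (A * A) * B).PosSemidef := by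
  have : B * (A * A) * B = (A * B)ᴴ * (A * B) := by
    rw [conjTranspose_mul, hA.isHermitian.eq, hB.isHermitian.eq]
    simp only [Matrix.mul_assoc]
  rw [this]
  exact posSemidef_conjTranspose_mul_self _

lemma norm_le_iff_le_smul_one {A : Matrix n n ℂ} (hA : A.PosSemidef) {c : ℝ} (hc : 0 ≤ c) :
    ‖A‖ ≤ c ↔ A ≤ c • (1 : Matrix n n ℂ) := by
  rw [CStarAlgebra.norm_le_iff_le_algebraMap A hc (nonneg_iff_posSemidef.2 hA),
    Algebra.algebraMap_eq_smul_one]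

lemma mpow_mul_self {A : Matrix n n ℂ} (hA : A.PosSemidef) {r : ℝ} (hr : r ≠ 0) :
    mpow (A * A) r = mpow A r * mpow A r := by
  have h : A * A = mpow A 2 := by
    conv_lhs => rw [← mpow_one hA, mpow_mul_mpow hA (by norm_num)]
    norm_num
  have h2 : r + r ≠ 0 := by simpa [← two_mul] using hr
  rw [h, mpow_mpow hA, mpow_mul_mpow hA h2, two_mul]

/-- For invertible B with inverse X and c = ‖AB‖², one has BA²B ≤ c, that is A² ≤ cX². Löwner–Heinz
turns this into A^(2r) ≤ c^r X^(2r), and conjugation by B^r returns to norms. -/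
lemma cordes_of_pos {A : Matrix n n ℂ} (hA : A.PosSemidef) {U : Matrix n n ℂ} (h1 : Uᴴ * U = 1)
    (h2 : U * Uᴴ = 1) {d : n → ℝ} (hd : ∀ i, 0 < d i) {r : ℝ} (hr : 0 < r) (hr1 : r ≤ 1) :
    ‖mpow A r * mpow (conjDiag U d) r‖ ≤ ‖A * conjDiag U d‖ ^ r := by
  set B := conjDiag U d with hBdef
  set X := conjDiag U (fun i => (d i)⁻¹) with hX
  have hB : B.PosSemidef := conjDiag_posSemidef U fun i => (hd i).le
  have hXp : X.PosSemidef := conjDiag_posSemidef U fun i => (inv_pos.2 (hd i)).le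
  have hXB : X * B = 1 := by
    have : (fun i => (d i)⁻¹ * d i) = fun _ => (1 : ℝ) := by
      ext i
      exact inv_mul_cancel₀ (hd i).ne'
    rw [hX, hBdef, conjDiag_mul h1, this, conjDiag_const h2, one_smul]
  have hBX : B * X = 1 := by rwa [mul_eq_one_comm]
  set c := ‖A * B‖ ^ 2
  have hc : 0 ≤ c := by positivity
  have hle : B * (A * A) * B ≤ c • (1 : Matrix n n ℂ) :=
    (norm_le_iff_le_smul_one (posSemidef_conj_sq hA hB) hc).1 (norm_mul_self_eq hA hB).le
  have hle2 : A * A ≤ c • (X * X) := by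
    have := conjugate_le_conjugate_of_nonneg hle (nonneg_iff_posSemidef.2 hXp)
    have e : X * (B * (A * A) * B) * X = (X * B) * (A * A) * (B * X) := by
      simp only [Matrix.mul_assoc]
    rwa [e, hXB, hBX, Matrix.one_mul, Matrix.mul_one, Matrix.mul_smul, Matrix.smul_mul,
      Matrix.mul_one] at this
  have hAA : (A * A).PosSemidef := by
    simpa using posSemidef_conj_sq hA PosSemidef.one
  have hXX : (X * X).PosSemidef := by
    simpa using posSemidef_conj_sq hXp PosSemidef.one
  have hle3 := mpow_le_mpow hAA hle2 hr.le hr1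
  rw [mpow_smul hXX hc, mpow_mul_self hA hr.ne', mpow_mul_self hXp hr.ne'] at hle3
  have hBr := mpow_posSemidef hB r
  have hle4 := conjugate_le_conjugate_of_nonneg hle3 (nonneg_iff_posSemidef.2 hBr)
  have hXr : mpow X r * mpow B r = 1 := by
    have : (fun i => (d i)⁻¹ ^ r * d i ^ r) = fun _ => (1 : ℝ) := by
      ext i
      rw [← Real.mul_rpow (inv_pos.2 (hd i)).le (hd i).le, inv_mul_cancel₀ (hd i).ne',
        Real.one_rpow]
    rw [hX, hBdef, mpow_conjDiag h1 h2, mpow_conjDiag h1 h2, conjDiag_mul h1, this,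
      conjDiag_const h2, one_smul]
  have hXr' : mpow B r * mpow X r = 1 := by rwa [mul_eq_one_comm]
  have e : mpow B r * (c ^ r • (mpow X r * mpow X r)) * mpow B r = c ^ r • 1 := by
    have : mpow B r * (mpow X r * mpow X r) * mpow B r
        = (mpow B r * mpow X r) * (mpow X r * mpow B r) := by simp only [Matrix.mul_assoc]
    rw [Matrix.mul_smul, Matrix.smul_mul, this, hXr, hXr', Matrix.one_mul]
  rw [e, ← norm_le_iff_le_smul_one (posSemidef_conj_sq (mpow_posSemidef hA r) hBr)
    (by positivity), norm_mul_self_eq (mpow_posSemidef hA r) hBr] at hle4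
  have e2 : c ^ r = (‖A * B‖ ^ r) ^ 2 := by
    exact (Real.rpow_pow_comm (norm_nonneg _) r 2).symm
  rw [e2] at hle4
  exact (pow_le_pow_iff_left₀ (norm_nonneg _) (by positivity) two_ne_zero).1 hle4

lemma continuous_conjDiag (U : Matrix n n ℂ) : Continuous (conjDiag U) := by
  unfold conjDiag
  fun_prop

/-- The Cordes inequality. -/
lemma norm_mpow_mul_mpow_le {A B : Matrix n n ℂ} (hA : A.PosSemidef) (hB : B.PosSemidef) {r : ℝ}
    (hr : 0 < r) (hr1 : r ≤ 1) : ‖mpow A r * mpow B r‖ ≤ ‖A * B‖ ^ r := by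
  obtain ⟨U, h1, h2, h3, h4⟩ := exists_conjDiag hB
  set d := hB.isHermitian.eigenvalues
  -- The eigenvalues of `B` are shifted by ε > 0 to make it invertible. Since r > 0, both sides are
  -- continuous at ε = 0 even where an eigenvalue vanishes.
  have key : ∀ᶠ ε in 𝓝[>] (0 : ℝ), ‖mpow A r * conjDiag U (fun i => (d i + ε) ^ r)‖
      ≤ ‖A * conjDiag U (fun i => d i + ε)‖ ^ r := by
    filter_upwards [self_mem_nhdsWithin] with ε hε
    have := cordes_of_pos hA h1 h2 (d := fun i => d i + ε)
      (fun i => add_pos_of_nonneg_of_pos (h4 i) hε) hr hr1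
    rwa [mpow_conjDiag h1 h2] at this
  have hc1 : Continuous fun ε : ℝ => ‖mpow A r * conjDiag U (fun i => (d i + ε) ^ r)‖ := by
    refine (continuous_const.mul ((continuous_conjDiag U).comp ?_)).norm
    exact continuous_pi fun i => (continuous_const.add continuous_id).rpow_const
      fun _ => Or.inr hr.le
  have hc2 : Continuous fun ε : ℝ => ‖A * conjDiag U (fun i => d i + ε)‖ ^ r := by
    refine Continuous.rpow_const ?_ fun _ => Or.inr hr.le
    exact (continuous_const.mul ((continuous_conjDiag U).comp (by fun_prop))).norm
  have l1 := (hc1.tendsto 0).mono_left (nhdsWithin_le_nhds (s := Set.Ioi 0))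
  have l2 := (hc2.tendsto 0).mono_left (nhdsWithin_le_nhds (s := Set.Ioi 0))
  have := le_of_tendsto_of_tendsto l1 l2 key
  simp only [add_zero] at this
  rw [h3, mpow_conjDiag h1 h2]
  exact this

/-! ### Compound matrices and products of the largest eigenvalues -/

/-- Enumeration of the index type compatible with the ordering of the eigenvalues. -/
def enum : Fin (Fintype.card n) ≃ n := Fintype.equivOfCardEq (Fintype.card_fin _)

/-- The `k`-th compound matrix, whose entries are the `k × k` minors. -/
def compound (k : ℕ) (M : Matrix n n ℂ) :
    Matrix (Fin k ↪o Fin (Fintype.card n)) (Fin k ↪o Fin (Fintype.card n)) ℂ :=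
  of fun f g => (M.submatrix (enum ∘ f) (enum ∘ g)).det

/-- An injection is determined by its range, hence by an increasing map, together with the
permutation that sorts its values. This groups the terms of the Cauchy–Binet expansion. -/
lemma bijective_orderEmb_perm (k N : ℕ) :
    Function.Bijective fun x : (Fin k ↪o Fin N) × Equiv.Perm (Fin k) =>
      (⟨x.1 ∘ x.2, x.1.injective.comp x.2.injective⟩ : {h : Fin k → Fin N // h.Injective}) := by
  constructor
  · rintro ⟨f, π⟩ ⟨g, τ⟩ h
    have h' : f ∘ π = g ∘ τ := congrArg Subtype.val h
    have hr : Set.range f = Set.range g := by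
      rw [← π.surjective.range_comp f, ← τ.surjective.range_comp g, h']
    have hfg : f = g := DFunLike.coe_injective ((f.strictMono.range_inj g.strictMono).1 hr)
    subst hfg
    have : π = τ := by
      ext a
      have := congrFun h' a
      exact congrArg Fin.val (f.injective this)
    rw [this]
  · rintro ⟨h, hh⟩
    have hm : StrictMono (h ∘ Tuple.sort h) :=
      (Tuple.monotone_sort h).strictMono_of_injective (hh.comp (Tuple.sort h).injective)
    refine ⟨(OrderEmbedding.ofStrictMono _ hm, (Tuple.sort h)⁻¹), ?_⟩
    ext a
    simp

lemma sum_injective_eq {k N : ℕ} (F : (Fin k → Fin N) → ℂ) (hF : ∀ h, ¬ h.Injective → F h = 0) :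
    ∑ h, F h = ∑ f : Fin k ↪o Fin N, ∑ π : Equiv.Perm (Fin k), F (f ∘ π) := by
  classical
  calc ∑ h, F h = ∑ h ∈ Finset.univ.filter Function.Injective, F h := by
        rw [Finset.sum_filter]
        refine Finset.sum_congr rfl fun h _ => ?_
        split_ifs with hh
        · rfl
        · exact hF h hh
    _ = ∑ h : {h : Fin k → Fin N // h.Injective}, F h.1 :=
        Finset.sum_subtype _ (by simp) _
    _ = ∑ x : (Fin k ↪o Fin N) × Equiv.Perm (Fin k), F (x.1 ∘ x.2) :=
        ((bijective_orderEmb_perm k N).sum_comp fun h => F h.1).symm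
    _ = _ := Fintype.sum_prod_type' fun (f : Fin k ↪o Fin N) (π : Equiv.Perm (Fin k)) => F (f ∘ π)

/-- The Cauchy–Binet formula. -/
lemma compound_mul (k : ℕ) (M N : Matrix n n ℂ) :
    compound k (M * N) = compound k M * compound k N := by
  ext f g
  -- Multilinearity in the columns gives a sum over all maps `h`. Non-injective `h` repeat a column
  -- of the minor of `M`; the others are an increasing map after a permutation, whose signs assemble
  -- the minor of `N`.
  have e1 : compound k (M * N) f g
      = ∑ h : Fin k → Fin (Fintype.card n),
        (M.submatrix (enum ∘ f) (enum ∘ h)).det * ∏ a, N (enum (h a)) (enum (g a)) := by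
    have e2 : ∀ i j, (M * N) i j
        = ∑ c : Fin (Fintype.card n), M i (enum c) * N (enum c) j := fun i j => by
      rw [Matrix.mul_apply, ← enum.sum_comp]
    rw [compound, of_apply, det_apply']
    simp only [submatrix_apply, e2, Finset.prod_univ_sum, Fintype.piFinset_univ, Finset.mul_sum,
      det_apply', Finset.sum_mul]
    rw [Finset.sum_comm]
    refine Finset.sum_congr rfl fun h _ => Finset.sum_congr rfl fun π _ => ?_
    rw [Finset.prod_mul_distrib]
    simp only [Function.comp_apply]
    ring
  rw [e1, sum_injective_eq, Matrix.mul_apply]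
  · refine Finset.sum_congr rfl fun h _ => ?_
    have : ∀ π : Equiv.Perm (Fin k),
        (M.submatrix (enum ∘ f) (enum ∘ (h ∘ π))).det * ∏ a, N (enum ((h ∘ π) a)) (enum (g a))
        = compound k M f h *
          ((Equiv.Perm.sign π : ℤ) * ∏ a, N (enum (h (π a))) (enum (g a))) := by
      intro π
      have := det_permute' π (M.submatrix (enum ∘ f) (enum ∘ h))
      rw [submatrix_submatrix] at this
      rw [Function.comp_id] at this
      rw [show (enum ∘ (h ∘ π) : Fin k → n) = (enum ∘ h) ∘ π from rfl, this]
      simp only [compound, of_apply, Function.comp_apply]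
      ring
    rw [Finset.sum_congr rfl fun π _ => this π, ← Finset.mul_sum]
    congr 1
    simp only [compound, of_apply]
    rw [det_apply']
    rfl
  · intro h hh
    rw [Function.not_injective_iff] at hh
    obtain ⟨a, b, hab, hne⟩ := hh
    rw [det_zero_of_column_eq hne, zero_mul]
    intro i
    simp [hab]

lemma compound_diagonal (k : ℕ) (d : n → ℂ) :
    compound k (diagonal d) = diagonal fun f => ∏ a, d (enum (f a)) := by
  ext f g
  rw [compound, of_apply]
  by_cases h : f = g
  · subst h
    rw [diagonal_apply_eq, submatrix_diagonal _ _ (enum.injective.comp f.injective), det_diagonal]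
    rfl
  · rw [diagonal_apply_ne _ h]
    -- Distinct increasing maps have distinct ranges of equal size, so some row of the minor misses
    -- every selected column and vanishes.
    have : ∃ a, f a ∉ Set.range g := by
      by_contra! hc
      apply h
      have hs : Set.range f ⊆ Set.range g := by
        rintro _ ⟨a, rfl⟩
        exact hc a
      have hr : Set.range f = Set.range g := by
        apply Set.eq_of_subset_of_ncard_le hs
        rw [← Set.image_univ, ← Set.image_univ, Set.ncard_image_of_injective _ f.injective,
          Set.ncard_image_of_injective _ g.injective]
      exact DFunLike.coe_injective ((f.strictMono.range_inj g.strictMono).1 hr)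
    obtain ⟨a, ha⟩ := this
    apply det_eq_zero_of_row_eq_zero a
    intro b
    rw [submatrix_apply, diagonal_apply_ne]
    intro e
    exact ha ⟨b, (enum.injective e).symm⟩

lemma compound_one (k : ℕ) : compound k (1 : Matrix n n ℂ) = 1 := by
  rw [← diagonal_one, compound_diagonal]
  simp

lemma compound_conjTranspose (k : ℕ) (M : Matrix n n ℂ) :
    compound k Mᴴ = (compound k M)ᴴ := by
  ext f g
  rw [conjTranspose_apply, compound, compound, of_apply, of_apply, ← det_conjTranspose]
  rfl

lemma compound_conjDiag (k : ℕ) (U : Matrix n n ℂ) (d : n → ℝ) :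
    compound k (conjDiag U d) = conjDiag (compound k U) fun f => ∏ a, d (enum (f a)) := by
  rw [conjDiag, conjDiag, compound_mul, compound_mul, compound_conjTranspose, compound_diagonal]
  simp

lemma compound_posSemidef (k : ℕ) {A : Matrix n n ℂ} (hA : A.PosSemidef) :
    (compound k A).PosSemidef := by
  obtain ⟨U, h1, h2, h3, h4⟩ := exists_conjDiag hA
  rw [h3, compound_conjDiag]
  exact conjDiag_posSemidef _ fun f => Finset.prod_nonneg fun a _ => h4 _

lemma compound_mpow (k : ℕ) {A : Matrix n n ℂ} (hA : A.PosSemidef) (r : ℝ) :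
    compound k (mpow A r) = mpow (compound k A) r := by
  obtain ⟨U, h1, h2, h3, h4⟩ := exists_conjDiag hA
  have k1 : (compound k U)ᴴ * compound k U = 1 := by
    rw [← compound_conjTranspose, ← compound_mul, h1, compound_one]
  have k2 : compound k U * (compound k U)ᴴ = 1 := by
    rw [← compound_conjTranspose, ← compound_mul, h2, compound_one]
  rw [h3, mpow_conjDiag h1 h2, compound_conjDiag, compound_conjDiag, mpow_conjDiag k1 k2]
  congr 1
  ext f
  rw [Real.finsetProd_rpow _ _ fun a _ => h4 _]

lemma norm_conjDiag {U : Matrix n n ℂ} (h1 : Uᴴ * U = 1) (h2 : U * Uᴴ = 1) (d : n → ℝ) :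
    ‖conjDiag U d‖ = ‖d‖ := by
  have hU : U ∈ unitary (Matrix n n ℂ) := ⟨h1, h2⟩
  have hU' : Uᴴ ∈ unitary (Matrix n n ℂ) := Unitary.star_mem hU
  rw [conjDiag, CStarRing.norm_mul_mem_unitary _ hU', CStarRing.norm_mem_unitary_mul _ hU,
    l2_opNorm_diagonal]
  simp [Pi.norm_def]

/-- The eigenvalues of a Hermitian matrix in decreasing order, extended by zero. -/
def eig {A : Matrix n n ℂ} (hA : A.PosSemidef) (i : ℕ) : ℝ :=
  if h : i < Fintype.card n then hA.isHermitian.eigenvalues₀ ⟨i, h⟩ else 0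

lemma eig_nonneg {A : Matrix n n ℂ} (hA : A.PosSemidef) (i : ℕ) : 0 ≤ eig hA i := by
  unfold eig
  split_ifs with h
  · have := hA.eigenvalues_nonneg (enum ⟨i, h⟩)
    simpa [Matrix.IsHermitian.eigenvalues, enum] using this
  · exact le_rfl

lemma eig_antitone {A : Matrix n n ℂ} (hA : A.PosSemidef) : Antitone (eig hA) := by
  intro i j hij
  by_cases h : j < Fintype.card n
  · have hi : i < Fintype.card n := hij.trans_lt h
    simp only [eig, h, hi, dif_pos]
    exact hA.isHermitian.eigenvalues₀_antitone hij
  · have : eig hA j = 0 := by simp [eig, h]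
    rw [this]
    exact eig_nonneg hA i

lemma eigenvalues_enum {A : Matrix n n ℂ} (hA : A.PosSemidef) (i : Fin (Fintype.card n)) :
    hA.isHermitian.eigenvalues (enum i) = eig hA i := by
  simp [Matrix.IsHermitian.eigenvalues, enum, eig]

lemma rtr_mpow_eq_sum_eig {A : Matrix n n ℂ} (hA : A.PosSemidef) (s : ℝ) :
    rtr (mpow A s) = ∑ i ∈ Finset.range (Fintype.card n), eig hA i ^ s := by
  rw [rtr_mpow hA, ← enum.sum_comp, ← Fin.sum_univ_eq_sum_range (fun i => eig hA i ^ s)]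
  simp only [eigenvalues_enum hA]

/-- The norm of the `k`-th compound is the product of the `k` largest eigenvalues. -/
lemma norm_compound {A : Matrix n n ℂ} (hA : A.PosSemidef) {k : ℕ} (hk : k ≤ Fintype.card n) :
    ‖compound k A‖ = ∏ i ∈ Finset.range k, eig hA i := by
  obtain ⟨U, h1, h2, h3, h4⟩ := exists_conjDiag hA
  have k1 : (compound k U)ᴴ * compound k U = 1 := by
    rw [← compound_conjTranspose, ← compound_mul, h1, compound_one]
  have k2 : compound k U * (compound k U)ᴴ = 1 := by
    rw [← compound_conjTranspose, ← compound_mul, h2, compound_one]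
  conv_lhs => rw [h3]
  rw [compound_conjDiag, norm_conjDiag k1 k2, ← Fin.prod_univ_eq_prod_range]
  simp only [eigenvalues_enum hA]
  have hnn : ∀ f : Fin k ↪o Fin (Fintype.card n), 0 ≤ ∏ a, eig hA (f a) := fun f =>
    Finset.prod_nonneg fun a _ => eig_nonneg hA _
  apply le_antisymm
  · refine (pi_norm_le_iff_of_nonneg (Finset.prod_nonneg fun a _ => eig_nonneg hA _)).2 fun f => ?_
    rw [Real.norm_of_nonneg (hnn f)]
    refine Finset.prod_le_prod (fun a _ => eig_nonneg hA _) fun a _ => eig_antitone hA ?_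
    -- A strictly increasing `f` satisfies f a ≥ a, so no choice of k eigenvalues beats the first k;
    -- the initial segment attains the maximum.
    have : ∀ a : ℕ, ∀ h : a < k, a ≤ (f ⟨a, h⟩ : ℕ) := by
      intro a
      induction a with
      | zero => intro h; exact Nat.zero_le _
      | succ a ih =>
        intro h
        have h1 := ih (by omega)
        have h2 : f ⟨a, by omega⟩ < f ⟨a + 1, h⟩ := f.strictMono (by simp [Fin.lt_def])
        have h3 : (f ⟨a, by omega⟩ : ℕ) < f ⟨a + 1, h⟩ := h2
        omega
    exact this a a.2
  · have := norm_le_pi_norm (fun f : Fin k ↪o Fin (Fintype.card n) => ∏ a, eig hA (f a))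
      (Fin.castLEOrderEmb hk)
    rw [Real.norm_of_nonneg (hnn _)] at this
    simpa using this

/-! ### Majorization and the scalar Hölder inequality -/

/-- Abel summation: as the partial sums of `l` are nonnegative, lowering the coefficient from `x N`
to `x (N + 1)` can only decrease the left side. -/
lemma mul_sum_le_sum_mul_of_antitone {x l : ℕ → ℝ} (hx : Antitone x) {N : ℕ}
    (hl : ∀ k ≤ N, 0 ≤ ∑ i ∈ Finset.range k, l i) :
    x N * ∑ i ∈ Finset.range N, l i ≤ ∑ i ∈ Finset.range N, x i * l i := by
  induction N with
  | zero => simp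
  | succ N ih =>
    rw [Finset.sum_range_succ (fun i => x i * l i)]
    have h1 := ih fun k hk => hl k (hk.trans N.le_succ)
    have h2 := mul_le_mul_of_nonneg_right (hx N.le_succ) (hl (N + 1) le_rfl)
    rw [Finset.sum_range_succ] at h2 ⊢
    linarith

/-- Weak log-majorization implies weak majorization. -/
lemma sum_le_sum_of_prod_le_prod {x y : ℕ → ℝ} (hx : Antitone x) (hx0 : ∀ i, 0 ≤ x i)
    (hy0 : ∀ i, 0 ≤ y i) {N : ℕ}
    (h : ∀ k ≤ N, ∏ i ∈ Finset.range k, x i ≤ ∏ i ∈ Finset.range k, y i) :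
    ∑ i ∈ Finset.range N, x i ≤ ∑ i ∈ Finset.range N, y i := by
  induction N with
  | zero => simp
  | succ N ih =>
    -- If the smallest `x` vanishes, its term is dropped. Otherwise all `x i` and `y i` in range are
    -- positive and logarithms are available.
    rcases (hx0 N).eq_or_lt with h0 | h0
    · rw [Finset.sum_range_succ, Finset.sum_range_succ, ← h0]
      linarith [ih fun k hk => h k (hk.trans N.le_succ), hy0 N]
    · have hxp : ∀ i ∈ Finset.range (N + 1), 0 < x i := fun i hi =>
        h0.trans_le (hx (Nat.lt_succ_iff.1 (Finset.mem_range.1 hi)))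
      have hyp : ∀ i ∈ Finset.range (N + 1), 0 < y i := by
        have : 0 < ∏ i ∈ Finset.range (N + 1), y i :=
          (Finset.prod_pos hxp).trans_le (h _ le_rfl)
        intro i hi
        exact (hy0 i).lt_of_ne fun e => this.ne' (Finset.prod_eq_zero hi e.symm)
      have hl : ∀ k ≤ N + 1, 0 ≤ ∑ i ∈ Finset.range k, Real.log (y i / x i) := by
        intro k hk
        have hs : Finset.range k ⊆ Finset.range (N + 1) := Finset.range_subset_range.2 hk
        rw [← Real.log_prod fun i hi => (div_pos (hyp i (hs hi)) (hxp i (hs hi))).ne',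
          Finset.prod_div_distrib]
        apply Real.log_nonneg
        rw [le_div_iff₀ (Finset.prod_pos fun i hi => hxp i (hs hi)), one_mul]
        exact h k hk
      have h1 := mul_sum_le_sum_mul_of_antitone hx hl
      have h2 := mul_nonneg (hx0 (N + 1)) (hl (N + 1) le_rfl)
      -- The tangent bound log u ≤ u - 1 at u = y/x gives x log (y/x) ≤ y - x; Abel summation makes
      -- the sum of the left sides nonnegative.
      have h3 : ∑ i ∈ Finset.range (N + 1), x i * Real.log (y i / x i)
          ≤ ∑ i ∈ Finset.range (N + 1), (y i - x i) := by
        refine Finset.sum_le_sum fun i hi => ?_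
        have h4 := Real.log_le_sub_one_of_pos (div_pos (hyp i hi) (hxp i hi))
        have h5 := mul_le_mul_of_nonneg_left h4 (hx0 i)
        have h6 : x i * (y i / x i - 1) = y i - x i := by
          have := (hxp i hi).ne'
          field_simp
        linarith
      rw [Finset.sum_sub_distrib] at h3
      linarith

lemma sum_rpow_le_sum_rpow_of_prod_le_prod {x y : ℕ → ℝ} (hx : Antitone x) (hx0 : ∀ i, 0 ≤ x i)
    (hy0 : ∀ i, 0 ≤ y i) {N : ℕ}
    (h : ∀ k ≤ N, ∏ i ∈ Finset.range k, x i ≤ ∏ i ∈ Finset.range k, y i) {p : ℝ} (hp : 0 ≤ p) :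
    ∑ i ∈ Finset.range N, x i ^ p ≤ ∑ i ∈ Finset.range N, y i ^ p := by
  refine sum_le_sum_of_prod_le_prod (fun i j hij => Real.rpow_le_rpow (hx0 _) (hx hij) hp)
    (fun i => Real.rpow_nonneg (hx0 i) _) (fun i => Real.rpow_nonneg (hy0 i) _) fun k hk => ?_
  rw [Real.finsetProd_rpow _ _ fun i _ => hx0 i, Real.finsetProd_rpow _ _ fun i _ => hy0 i]
  exact Real.rpow_le_rpow (Finset.prod_nonneg fun i _ => hx0 i) (h k hk) hp

/-- The Hölder inequality for three factors. -/
lemma sum_rpow_mul_le {ι : Type*} (s : Finset ι) {a b c : ι → ℝ} (ha : ∀ i, 0 ≤ a i)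
    (hb : ∀ i, 0 ≤ b i) (hc : ∀ i, 0 ≤ c i) {u v w : ℝ} (hu : 0 < u) (hv : 0 < v) (hw : 0 < w)
    (h : u + v + w = 1) :
    ∑ i ∈ s, a i ^ u * b i ^ v * c i ^ w
      ≤ (∑ i ∈ s, a i) ^ u * (∑ i ∈ s, b i) ^ v * (∑ i ∈ s, c i) ^ w := by
  have hA := Finset.sum_nonneg fun i (_ : i ∈ s) => ha i
  have hB := Finset.sum_nonneg fun i (_ : i ∈ s) => hb i
  have hC := Finset.sum_nonneg fun i (_ : i ∈ s) => hc i
  have hR : 0 ≤ (∑ i ∈ s, a i) ^ u * (∑ i ∈ s, b i) ^ v * (∑ i ∈ s, c i) ^ w := by positivity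
  rcases hA.eq_or_lt with h0 | hA'
  · refine (Finset.sum_eq_zero fun i hi => ?_).trans_le hR
    rw [(Finset.sum_eq_zero_iff_of_nonneg fun i _ => ha i).1 h0.symm i hi, Real.zero_rpow hu.ne']
    simp
  rcases hB.eq_or_lt with h0 | hB'
  · refine (Finset.sum_eq_zero fun i hi => ?_).trans_le hR
    rw [(Finset.sum_eq_zero_iff_of_nonneg fun i _ => hb i).1 h0.symm i hi, Real.zero_rpow hv.ne']
    simp
  rcases hC.eq_or_lt with h0 | hC'
  · refine (Finset.sum_eq_zero fun i hi => ?_).trans_le hR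
    rw [(Finset.sum_eq_zero_iff_of_nonneg fun i _ => hc i).1 h0.symm i hi, Real.zero_rpow hw.ne']
    simp
  set A := ∑ i ∈ s, a i
  set B := ∑ i ∈ s, b i
  set C := ∑ i ∈ s, c i
  have hR' : 0 < A ^ u * B ^ v * C ^ w := by positivity
  -- After normalizing the three sums to 1, the weighted AM–GM inequality applies termwise.
  rw [← div_le_one hR', Finset.sum_div]
  calc ∑ i ∈ s, a i ^ u * b i ^ v * c i ^ w / (A ^ u * B ^ v * C ^ w)
      ≤ ∑ i ∈ s, (u * (a i / A) + v * (b i / B) + w * (c i / C)) := by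
        refine Finset.sum_le_sum fun i _ => ?_
        have := Real.geom_mean_le_arith_mean3_weighted hu.le hv.le hw.le
          (div_nonneg (ha i) hA) (div_nonneg (hb i) hB) (div_nonneg (hc i) hC) h
        rw [Real.div_rpow (ha i) hA, Real.div_rpow (hb i) hB, Real.div_rpow (hc i) hC] at this
        rwa [div_mul_div_comm, div_mul_div_comm] at this
    _ = u * (A / A) + v * (B / B) + w * (C / C) := by
        rw [Finset.sum_add_distrib, Finset.sum_add_distrib, ← Finset.mul_sum, ← Finset.mul_sum,
          ← Finset.mul_sum, ← Finset.sum_div, ← Finset.sum_div, ← Finset.sum_div]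
    _ = 1 := by
        rw [div_self hA'.ne', div_self hB'.ne', div_self hC'.ne']
        linarith

/-! ### Trace inequalities between the two quasi-entropies -/

/-- The Araki–Lieb–Thirring inequality. -/
lemma rtr_mpow_conj_le {A B : Matrix n n ℂ} (hA : A.PosSemidef) (hB : B.PosSemidef) {r p : ℝ}
    (hr : 0 < r) (hr1 : r ≤ 1) (hp : 0 ≤ p) :
    rtr (mpow (mpow A r * (mpow B r * mpow B r) * mpow A r) p)
      ≤ rtr (mpow (A * (B * B) * A) (r * p)) := by
  have hAr := mpow_posSemidef hA r
  have hBr := mpow_posSemidef hB r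
  have h1 := posSemidef_conj_sq hBr hAr
  have h2 := posSemidef_conj_sq hB hA
  rw [rtr_mpow_eq_sum_eig h1, rtr_mpow_eq_sum_eig h2]
  simp only [Real.rpow_mul (eig_nonneg h2 _)]
  -- It suffices to compare products of the k largest eigenvalues, which are norms of k-th
  -- compounds; the comparison is the Cordes inequality for the compounds of `B` and `A`.
  refine sum_rpow_le_sum_rpow_of_prod_le_prod (eig_antitone h1) (eig_nonneg h1)
    (fun i => Real.rpow_nonneg (eig_nonneg h2 i) r) (fun k hk => ?_) hp
  rw [Real.finsetProd_rpow _ _ fun i _ => eig_nonneg h2 i, ← norm_compound h1 hk,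
    ← norm_compound h2 hk]
  have cA := compound_posSemidef k hA
  have cB := compound_posSemidef k hB
  simp only [compound_mul, compound_mpow k hA, compound_mpow k hB]
  rw [norm_mul_self_eq (mpow_posSemidef cB r) (mpow_posSemidef cA r), norm_mul_self_eq cB cA,
    ← Real.rpow_pow_comm (norm_nonneg _)]
  exact pow_le_pow_left₀ (norm_nonneg _) (norm_mpow_mul_mpow_le cB cA hr hr1) 2

lemma norm_compound_mul_conjTranspose (k : ℕ) (M : Matrix n n ℂ) :
    ‖compound k (M * Mᴴ)‖ = ‖compound k M‖ ^ 2 := by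
  rw [compound_mul, compound_conjTranspose, ← star_eq_conjTranspose,
    CStarRing.norm_self_mul_star, sq]

/-- The Hölder inequality for three factors in Schatten (quasi-)norms. -/
lemma rtr_mpow_mul_mul_le {X G Z : Matrix n n ℂ} (hX : X.PosSemidef) (hZ : Z.PosSemidef)
    {p u v w : ℝ} (hp : 0 ≤ p) (hu : 0 < u) (hv : 0 < v) (hw : 0 < w) (h : u + v + w = 1) :
    rtr (mpow ((X * G * Z) * (X * G * Z)ᴴ) p)
      ≤ rtr (mpow X (2 * p / u)) ^ u * rtr (mpow (G * Gᴴ) (p / v)) ^ v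
        * rtr (mpow Z (2 * p / w)) ^ w := by
  have hM := posSemidef_self_mul_conjTranspose (X * G * Z)
  have hG := posSemidef_self_mul_conjTranspose G
  simp only [rtr_mpow_eq_sum_eig hM, rtr_mpow_eq_sum_eig hG, rtr_mpow_eq_sum_eig hX,
    rtr_mpow_eq_sum_eig hZ]
  -- The left side involves squared singular values. `X` and `Z` are positive, so their eigenvalues
  -- get squared, while `eig hG` already belongs to `G * Gᴴ`.
  have hy : ∀ i, 0 ≤ eig hX i ^ 2 * eig hG i * eig hZ i ^ 2 := fun i =>
    mul_nonneg (mul_nonneg (sq_nonneg _) (eig_nonneg hG i)) (sq_nonneg _)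
  refine (sum_rpow_le_sum_rpow_of_prod_le_prod (eig_antitone hM) (eig_nonneg hM) hy
    (fun k hk => ?_) hp).trans ?_
  · rw [Finset.prod_mul_distrib, Finset.prod_mul_distrib, Finset.prod_pow, Finset.prod_pow,
      ← norm_compound hM hk, ← norm_compound hX hk, ← norm_compound hZ hk, ← norm_compound hG hk,
      norm_compound_mul_conjTranspose, norm_compound_mul_conjTranspose, ← mul_pow, ← mul_pow,
      compound_mul, compound_mul]
    refine pow_le_pow_left₀ (norm_nonneg _) ((norm_mul_le _ _).trans ?_) 2
    exact mul_le_mul_of_nonneg_right (norm_mul_le _ _) (norm_nonneg _)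
  · refine le_trans (le_of_eq ?_) (sum_rpow_mul_le _
      (fun i => Real.rpow_nonneg (eig_nonneg hX i) _)
      (fun i => Real.rpow_nonneg (eig_nonneg hG i) _)
      (fun i => Real.rpow_nonneg (eig_nonneg hZ i) _) hu hv hw h)
    refine Finset.sum_congr rfl fun i _ => ?_
    have hx := eig_nonneg hX i
    have hg := eig_nonneg hG i
    have hz := eig_nonneg hZ i
    rw [← Real.rpow_mul hx, ← Real.rpow_mul hg, ← Real.rpow_mul hz, div_mul_cancel₀ _ hu.ne',
      div_mul_cancel₀ _ hv.ne', div_mul_cancel₀ _ hw.ne', Real.mul_rpow (by positivity)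
      (by positivity), Real.mul_rpow (by positivity) hg, Real.rpow_mul hx, Real.rpow_mul hz]
    norm_num

lemma mpow_half_mul_self {A : Matrix n n ℂ} (hA : A.PosSemidef) {t : ℝ} (ht : t ≠ 0) :
    mpow A (t / 2) * mpow A (t / 2) = mpow A t := by
  rw [mpow_mul_mpow hA (by simpa using ht), add_halves]

lemma rtr_conj_eq {A : Matrix n n ℂ} (hA : A.PosSemidef) (B : Matrix n n ℂ) {t : ℝ} (ht : t ≠ 0) :
    rtr (mpow A (t / 2) * B * mpow A (t / 2)) = rtr (B * mpow A t) := by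
  rw [rtr_mul_comm, ← Matrix.mul_assoc, mpow_half_mul_self hA ht, rtr_mul_comm]

lemma conj_posSemidef {A B : Matrix n n ℂ} (hA : A.PosSemidef) (hB : B.PosSemidef) (s : ℝ) :
    (mpow A s * B * mpow A s).PosSemidef := by
  have := hB.mul_mul_conjTranspose_same (mpow A s)
  rwa [(mpow_posSemidef hA s).isHermitian.eq] at this

lemma petzQ_eq_rtr_mpow {ρ σ : Matrix n n ℂ} (hρ : ρ.PosSemidef) (hσ : σ.PosSemidef) {α : ℝ}
    (h1 : α ≠ 1) : petzQ α ρ σ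
      = rtr (mpow (mpow σ ((1 - α) / 2) * mpow ρ α * mpow σ ((1 - α) / 2)) 1) := by
  rw [mpow_one (conj_posSemidef hσ (mpow_posSemidef hρ _) _),
    rtr_conj_eq hσ _ (sub_ne_zero.2 h1.symm)]
  rfl

/-- Araki–Lieb–Thirring with r = α, p = 1, for σ^((1-α)/(2α)) and ρ^(1/2). -/
lemma petzQ_le_minimalQ {ρ σ : Matrix n n ℂ} (hρ : ρ.PosSemidef) (hσ : σ.PosSemidef) {α : ℝ}
    (h0 : 0 < α) (h1 : α < 1) : petzQ α ρ σ ≤ minimalQ α ρ σ := by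
  have := rtr_mpow_conj_le (mpow_posSemidef hσ ((1 - α) / (2 * α))) (mpow_posSemidef hρ (1 / 2))
    h0 h1.le zero_le_one
  rw [mpow_mpow hσ, mpow_mpow hρ, mpow_half_mul_self hρ one_ne_zero, mpow_one hρ, mul_one] at this
  have e1 : (1 - α) / (2 * α) * α = (1 - α) / 2 := by field_simp
  have e2 : 1 / 2 * α = α / 2 := by ring
  rw [e1, e2, mpow_half_mul_self hρ h0.ne', ← petzQ_eq_rtr_mpow hρ hσ h1.ne] at this
  exact this

/-- Araki–Lieb–Thirring with r = 1/α, p = α, for σ^((1-α)/2) and ρ^(α/2). -/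
lemma minimalQ_le_petzQ {ρ σ : Matrix n n ℂ} (hρ : ρ.PosSemidef) (hσ : σ.PosSemidef) {α : ℝ}
    (h1 : 1 < α) : minimalQ α ρ σ ≤ petzQ α ρ σ := by
  have h0 : 0 < α := zero_lt_one.trans h1
  have := rtr_mpow_conj_le (mpow_posSemidef hσ ((1 - α) / 2)) (mpow_posSemidef hρ (α / 2))
    (inv_pos.2 h0) (inv_le_one_of_one_le₀ h1.le) h0.le
  rw [mpow_mpow hσ, mpow_mpow hρ, mpow_half_mul_self hρ h0.ne', inv_mul_cancel₀ h0.ne'] at this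
  have e1 : (1 - α) / 2 * α⁻¹ = (1 - α) / (2 * α) := by field_simp
  have e2 : α / 2 * α⁻¹ = 1 / 2 := by field_simp
  rw [e1, e2, mpow_half_mul_self hρ one_ne_zero, mpow_one hρ,
    ← petzQ_eq_rtr_mpow hρ hσ h1.ne'] at this
  exact this

lemma mul_mpow_half_mul_conjTranspose {ρ σ : Matrix n n ℂ} (hρ : ρ.PosSemidef)
    (hσ : σ.PosSemidef) (s : ℝ) {t : ℝ} (ht : t ≠ 0) :
    (mpow σ s * mpow ρ (t / 2)) * (mpow σ s * mpow ρ (t / 2))ᴴ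
      = mpow σ s * mpow ρ t * mpow σ s := by
  rw [conjTranspose_mul, (mpow_posSemidef hσ s).isHermitian.eq,
    (mpow_posSemidef hρ _).isHermitian.eq, ← mpow_half_mul_self hρ ht]
  simp only [Matrix.mul_assoc]

lemma mpow_mul_mul_mpow {ρ σ : Matrix n n ℂ} (hρ : ρ.PosSemidef) (hσ : σ.PosSemidef)
    {a b c d : ℝ} (h1 : a + b ≠ 0) (h2 : c + d ≠ 0) :
    mpow σ a * (mpow σ b * mpow ρ c) * mpow ρ d = mpow σ (a + b) * mpow ρ (c + d) := by
  rw [← mpow_mul_mpow hσ h1, ← mpow_mul_mpow hρ h2]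
  simp only [Matrix.mul_assoc]

/-- In the Hölder factorization the middle factor is σ^((1-α)/2) ρ^(α/2), whose contribution is
`petzQ`. The weights (1-α)², α, α(1-α) are those for which the outer factors contribute exactly tr σ
and tr ρ. -/
lemma minimalQ_le_rpow {ρ σ : Matrix n n ℂ} (hρ : ρ.PosSemidef) (hσ : σ.PosSemidef) {α : ℝ}
    (h0 : 0 < α) (h1 : α < 1) :
    minimalQ α ρ σ
      ≤ rtr σ ^ ((1 - α) ^ 2) * petzQ α ρ σ ^ α * rtr ρ ^ (α * (1 - α)) := by
  have h1' : 0 < 1 - α := sub_pos.2 h1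
  have := rtr_mpow_mul_mul_le (X := mpow σ ((1 - α) ^ 2 / (2 * α)))
    (G := mpow σ ((1 - α) / 2) * mpow ρ (α / 2)) (Z := mpow ρ ((1 - α) / 2))
    (mpow_posSemidef hσ _) (mpow_posSemidef hρ _) (p := α) (u := (1 - α) ^ 2) (v := α)
    (w := α * (1 - α)) h0.le (by positivity) h0 (by positivity) (by ring)
  have e1 : (1 - α) ^ 2 / (2 * α) + (1 - α) / 2 = (1 - α) / (2 * α) := by field_simp; ring
  have e2 : α / 2 + (1 - α) / 2 = 1 / 2 := by ring
  have e3 : (1 - α) ^ 2 / (2 * α) * (2 * α / (1 - α) ^ 2) = 1 := by field_simp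
  have e4 : (1 - α) / 2 * (2 * α / (α * (1 - α))) = 1 := by field_simp
  have e5 : (1 - α) / (2 * α) ≠ 0 := by positivity
  rw [mpow_mul_mul_mpow hρ hσ (by rw [e1]; exact e5) (by rw [e2]; norm_num), e1, e2,
    mul_mpow_half_mul_conjTranspose hρ hσ _ one_ne_zero,
    mul_mpow_half_mul_conjTranspose hρ hσ _ h0.ne', mpow_mpow hσ, mpow_mpow hρ, e3, e4,
    mpow_one hρ, mpow_one hσ, div_self h0.ne', ← petzQ_eq_rtr_mpow hρ hσ h1.ne] at this
  exact this

/-- The roles are exchanged: σ^((1-α)/2) ρ^(α/2) is factored through σ^((1-α)/(2α)) ρ^(1/2). The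
condition α < 2 keeps the last weight positive. The weight of the σ factor is of second order in α -
1, so it disappears from the limit at 1. -/
lemma petzQ_le_rpow {ρ σ : Matrix n n ℂ} (hρ : ρ.PosSemidef) (hσ : σ.PosSemidef) {α : ℝ}
    (h1 : 1 < α) (h2 : α < 2) :
    petzQ α ρ σ ≤ rtr (mpow σ (-1)) ^ ((α - 1) ^ 2 / α) * minimalQ α ρ σ ^ (1 / α)
      * rtr (mpow ρ (α / (2 - α))) ^ ((α - 1) * (2 - α) / α) := by
  have h0 : 0 < α := zero_lt_one.trans h1
  have h1' : 0 < α - 1 := sub_pos.2 h1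
  have h2' : 0 < 2 - α := sub_pos.2 h2
  have := rtr_mpow_mul_mul_le (X := mpow σ (-(α - 1) ^ 2 / (2 * α)))
    (G := mpow σ ((1 - α) / (2 * α)) * mpow ρ (1 / 2)) (Z := mpow ρ ((α - 1) / 2))
    (mpow_posSemidef hσ _) (mpow_posSemidef hρ _) (p := 1) (u := (α - 1) ^ 2 / α) (v := 1 / α)
    (w := (α - 1) * (2 - α) / α) zero_le_one (by positivity) (by positivity) (by positivity)
    (by field_simp; ring)
  have e1 : -(α - 1) ^ 2 / (2 * α) + (1 - α) / (2 * α) = (1 - α) / 2 := by field_simp; ring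
  have e2 : 1 / 2 + (α - 1) / 2 = α / 2 := by ring
  have e3 : -(α - 1) ^ 2 / (2 * α) * (2 * 1 / ((α - 1) ^ 2 / α)) = -1 := by field_simp
  have e4 : (α - 1) / 2 * (2 * 1 / ((α - 1) * (2 - α) / α)) = α / (2 - α) := by field_simp
  have e5 : (1 - α) / 2 ≠ 0 := by linarith
  rw [mpow_mul_mul_mpow hρ hσ (by rw [e1]; exact e5) (by rw [e2]; positivity), e1, e2,
    mul_mpow_half_mul_conjTranspose hρ hσ _ h0.ne',
    mul_mpow_half_mul_conjTranspose hρ hσ _ one_ne_zero, mpow_mpow hσ, mpow_mpow hρ, e3, e4,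
    mpow_one hρ, one_div_one_div, ← petzQ_eq_rtr_mpow hρ hσ h1.ne'] at this
  exact this

/-! ### Convergence of the minimal quasi-entropy at 0 -/

lemma mpow_le_self {A : Matrix n n ℂ} (hA : A.PosSemidef) (h : ‖A‖ ≤ 1) {q : ℝ} (hq : 1 ≤ q) :
    mpow A q ≤ A := by
  obtain ⟨U, h1, h2, h3, h4⟩ := exists_conjDiag hA
  set d := hA.isHermitian.eigenvalues
  have hd : ∀ i, d i ≤ 1 := by
    rw [h3, norm_conjDiag h1 h2] at h
    intro i
    have := (norm_le_pi_norm d i).trans h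
    rwa [Real.norm_of_nonneg (h4 i)] at this
  have e : mpow A q + conjDiag U (fun i => d i - d i ^ q) = A := by
    rw [h3, mpow_conjDiag h1 h2, conjDiag_add]
    simp
  have hp : (conjDiag U (fun i => d i - d i ^ q)).PosSemidef := by
    refine conjDiag_posSemidef U fun i => sub_nonneg.2 ?_
    exact Real.rpow_le_self_of_le_one (h4 i) (hd i) hq
  rw [Matrix.le_iff]
  rwa [eq_sub_of_add_eq' e] at hp

/-- For a contraction `ρ`, the trace of `(σ^(t/2) ρ σ^(t/2))^(1/t)` increases with `t`. -/
lemma rtr_mpow_conj_monotone {ρ σ : Matrix n n ℂ} (hρ : ρ.PosSemidef) (hσ : σ.PosSemidef)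
    (h : ‖ρ‖ ≤ 1) {s t : ℝ} (hs : 1 ≤ s) (hst : s ≤ t) :
    rtr (mpow (mpow σ (s / 2) * ρ * mpow σ (s / 2)) (1 / s))
      ≤ rtr (mpow (mpow σ (t / 2) * ρ * mpow σ (t / 2)) (1 / t)) := by
  have hs0 : 0 < s := by linarith
  have ht0 : 0 < t := by linarith
  have hts : 0 < t / s := by positivity
  -- Araki–Lieb–Thirring with exponent s/t brings in ρ^(t/s), which is at most ρ for a contraction.
  -- Löwner–Heinz with exponent 1/t ≤ 1 removes the extra power.
  have h1 := rtr_mpow_conj_le (mpow_posSemidef hσ (t / 2)) (mpow_posSemidef hρ (t / s / 2))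
    (div_pos hs0 ht0) ((div_le_one ht0).2 hst) (one_div_pos.2 hs0).le
  have e1 : t / 2 * (s / t) = s / 2 := by field_simp
  have e2 : t / s / 2 * (s / t) = 1 / 2 := by field_simp
  have e3 : s / t * (1 / s) = 1 / t := by field_simp
  rw [mpow_mpow hσ, mpow_mpow hρ, e1, e2, e3, mpow_half_mul_self hρ one_ne_zero, mpow_one hρ,
    mpow_half_mul_self hρ hts.ne'] at h1
  refine h1.trans (rtr_mono ?_)
  refine mpow_le_mpow (conj_posSemidef hσ (mpow_posSemidef hρ _) _) ?_ (by positivity)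
    ((div_le_one ht0).2 (hs.trans hst))
  exact conjugate_le_conjugate_of_nonneg (mpow_le_self hρ h ((one_le_div hs0).2 hst))
    (nonneg_iff_posSemidef.2 (mpow_posSemidef hσ _))

lemma rtr_mpow_conj_le_rtr {ρ σ : Matrix n n ℂ} (hρ : ρ.PosSemidef) (hσ : σ.PosSemidef)
    (h : ‖ρ‖ ≤ 1) {t : ℝ} (ht : 1 ≤ t) :
    rtr (mpow (mpow σ (t / 2) * ρ * mpow σ (t / 2)) (1 / t)) ≤ rtr σ := by
  have ht0 : 0 < t := by linarith
  have hρ1 : ρ ≤ 1 := by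
    have := (norm_le_iff_le_smul_one hρ zero_le_one).1 h
    rwa [one_smul] at this
  have h1 : mpow σ (t / 2) * ρ * mpow σ (t / 2) ≤ mpow σ t := by
    have := conjugate_le_conjugate_of_nonneg hρ1
      (nonneg_iff_posSemidef.2 (mpow_posSemidef hσ (t / 2)))
    rwa [Matrix.mul_one, mpow_half_mul_self hσ ht0.ne'] at this
  have h2 := mpow_le_mpow (conj_posSemidef hσ hρ _) h1 (one_div_pos.2 ht0).le
    ((div_le_one ht0).2 ht)
  rw [mpow_mpow hσ, mul_one_div_cancel ht0.ne', mpow_one hσ] at h2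
  exact rtr_mono h2

lemma exists_tendsto_rtr_mpow_conj {ρ σ : Matrix n n ℂ} (hρ : ρ.PosSemidef) (hσ : σ.PosSemidef)
    (h : ‖ρ‖ ≤ 1) : ∃ L, Tendsto (fun t : ℝ =>
      rtr (mpow (mpow σ (t / 2) * ρ * mpow σ (t / 2)) (1 / t))) atTop (𝓝 L) := by
  set g : ℝ → ℝ := fun t => rtr (mpow (mpow σ (t / 2) * ρ * mpow σ (t / 2)) (1 / t))
  -- Monotonicity holds for t ≥ 1 only, hence the truncation.
  have hm : Monotone fun t => g (max t 1) := fun s t hst =>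
    rtr_mpow_conj_monotone hρ hσ h (le_max_right _ _) (max_le_max_right _ hst)
  have hb : BddAbove (Set.range fun t => g (max t 1)) := by
    refine ⟨rtr σ, ?_⟩
    rintro _ ⟨t, rfl⟩
    exact rtr_mpow_conj_le_rtr hρ hσ h (le_max_right _ _)
  refine ⟨_, (tendsto_atTop_ciSup hm hb).congr' ?_⟩
  filter_upwards [eventually_ge_atTop 1] with t ht
  rw [max_eq_left ht]

lemma rpow_one_sub_bounds {y M α : ℝ} (hy : 0 ≤ y) (hyM : y ≤ M) (h0 : 0 < α)
    (h1 : α < 1) : y ≤ y ^ (1 - α) * M ^ α ∧ y ^ (1 - α) ≤ (1 - α) * y + α := by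
  constructor
  · calc y = y ^ (1 - α + α) := by simp
      _ = y ^ (1 - α) * y ^ α := Real.rpow_add' hy (by simp)
      _ ≤ _ := mul_le_mul_of_nonneg_left (Real.rpow_le_rpow hy hyM h0.le) (Real.rpow_nonneg hy _)
  · have := Real.geom_mean_le_arith_mean2_weighted (sub_pos.2 h1).le h0.le hy zero_le_one
      (by ring)
    simpa using this

lemma tendsto_one_sub_div_atTop : Tendsto (fun α : ℝ => (1 - α) / α) (𝓝[>] 0) atTop := by
  have : Tendsto (fun α : ℝ => α⁻¹ - 1) (𝓝[>] 0) atTop :=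
    tendsto_atTop_add_const_right _ _ tendsto_inv_nhdsGT_zero
  refine this.congr' ?_
  filter_upwards [self_mem_nhdsWithin] with α hα
  have : α ≠ 0 := (Set.mem_Ioi.1 hα).ne'
  field_simp

lemma minimalQ_nonneg {ρ σ : Matrix n n ℂ} (hρ : ρ.PosSemidef) (hσ : σ.PosSemidef) (α : ℝ) :
    0 ≤ minimalQ α ρ σ :=
  rtr_nonneg (mpow_posSemidef (conj_posSemidef hσ hρ _) _)

/-- With t = (1-α)/α one has α = (1-α)/t, so `minimalQ` is the sum of y^(1-α), where the y are the
eigenvalues to the power 1/t and add up to the monotone trace. The bound 1 + tr σ on each y is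
positive even for σ = 0, so its α-th power tends to 1. -/
lemma minimalQ_bounds {ρ σ : Matrix n n ℂ} (hρ : ρ.PosSemidef) (hσ : σ.PosSemidef)
    (h : ‖ρ‖ ≤ 1) {α : ℝ} (h0 : 0 < α) (h1 : α ≤ 1 / 2) :
    rtr (mpow (mpow σ ((1 - α) / α / 2) * ρ * mpow σ ((1 - α) / α / 2)) (1 / ((1 - α) / α)))
      ≤ minimalQ α ρ σ * (1 + rtr σ) ^ α ∧
    minimalQ α ρ σ ≤ (1 - α) *
      rtr (mpow (mpow σ ((1 - α) / α / 2) * ρ * mpow σ ((1 - α) / α / 2)) (1 / ((1 - α) / α)))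
      + Fintype.card n * α := by
  set t := (1 - α) / α with ht
  have h1' : 0 < 1 - α := by linarith
  have ht1 : 1 ≤ t := by rw [ht, le_div_iff₀ h0]; linarith
  have ht0 : 0 < t := by linarith
  have hX := conj_posSemidef hσ hρ (t / 2)
  have e0 : (1 - α) / (2 * α) = t / 2 := by rw [ht]; field_simp
  have e1 : α = 1 / t * (1 - α) := by rw [ht]; field_simp
  have hg := rtr_mpow_conj_le_rtr hρ hσ h ht1
  have hQ : minimalQ α ρ σ = ∑ i ∈ Finset.range (Fintype.card n),
      (eig hX i ^ (1 / t)) ^ (1 - α) := by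
    rw [minimalQ, e0, rtr_mpow_eq_sum_eig hX]
    refine Finset.sum_congr rfl fun i _ => ?_
    rw [← Real.rpow_mul (eig_nonneg hX i), ← e1]
  rw [rtr_mpow_eq_sum_eig hX] at hg ⊢
  have hy : ∀ i, 0 ≤ eig hX i ^ (1 / t) := fun i => Real.rpow_nonneg (eig_nonneg hX i) _
  have hyM : ∀ i ∈ Finset.range (Fintype.card n), eig hX i ^ (1 / t) ≤ 1 + rtr σ := fun i hi => by
    have := (Finset.single_le_sum (f := fun i => eig hX i ^ (1 / t)) (fun i _ => hy i) hi).trans hg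
    linarith
  have hb := fun i hi => rpow_one_sub_bounds (hy i) (hyM i hi) h0 (by linarith : α < 1)
  rw [hQ]
  constructor
  · rw [Finset.sum_mul]
    exact Finset.sum_le_sum fun i hi => (hb i hi).1
  · refine (Finset.sum_le_sum fun i hi => (hb i hi).2).trans (le_of_eq ?_)
    rw [Finset.sum_add_distrib, ← Finset.mul_sum]
    simp

lemma exists_tendsto_minimalQ_of_norm_le_one {ρ σ : Matrix n n ℂ} (hρ : ρ.PosSemidef)
    (hσ : σ.PosSemidef) (h : ‖ρ‖ ≤ 1) :
    ∃ L, Tendsto (fun α => minimalQ α ρ σ) (𝓝[>] 0) (𝓝 L) := by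
  obtain ⟨L, hL⟩ := exists_tendsto_rtr_mpow_conj hρ hσ h
  have hg := hL.comp tendsto_one_sub_div_atTop
  set g : ℝ → ℝ := (fun t : ℝ => rtr (mpow (mpow σ (t / 2) * ρ * mpow σ (t / 2)) (1 / t))) ∘
    fun α : ℝ => (1 - α) / α
  have hα : Tendsto (fun α : ℝ => α) (𝓝[>] 0) (𝓝 0) := tendsto_nhdsWithin_of_tendsto_nhds tendsto_id
  have hM : 0 < 1 + rtr σ := by linarith [rtr_nonneg hσ]
  have hMα : Tendsto (fun α : ℝ => (1 + rtr σ) ^ α) (𝓝[>] 0) (𝓝 1) := by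
    have := (Real.continuous_const_rpow hM.ne').tendsto 0
    rw [Real.rpow_zero] at this
    exact this.mono_left nhdsWithin_le_nhds
  have l1 : Tendsto (fun α => g α / (1 + rtr σ) ^ α) (𝓝[>] 0) (𝓝 L) := by
    have := hg.div hMα one_ne_zero
    rw [div_one] at this
    exact this
  have l2 : Tendsto (fun α => (1 - α) * g α + Fintype.card n * α) (𝓝[>] 0) (𝓝 L) := by
    simpa using ((tendsto_const_nhds (x := (1 : ℝ)).sub hα).mul hg).add
      (tendsto_const_nhds (x := (Fintype.card n : ℝ)).mul hα)
  have hev : ∀ᶠ α : ℝ in 𝓝[>] 0, 0 < α ∧ α ≤ 1 / 2 := by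
    filter_upwards [Ioc_mem_nhdsGT (show (0 : ℝ) < 1 / 2 by norm_num)] with α h using h
  refine ⟨L, tendsto_of_tendsto_of_tendsto_of_le_of_le' l1 l2 ?_ ?_⟩
  · filter_upwards [hev] with α hα
    rw [div_le_iff₀ (Real.rpow_pos_of_pos hM _)]
    exact (minimalQ_bounds hρ hσ h hα.1 hα.2).1
  · filter_upwards [hev] with α hα
    exact (minimalQ_bounds hρ hσ h hα.1 hα.2).2

lemma minimalQ_smul {ρ σ : Matrix n n ℂ} (hρ : ρ.PosSemidef) (hσ : σ.PosSemidef) {c : ℝ}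
    (hc : 0 ≤ c) (α : ℝ) : minimalQ α (c • ρ) σ = c ^ α * minimalQ α ρ σ := by
  rw [minimalQ, Matrix.mul_smul, Matrix.smul_mul, mpow_smul (conj_posSemidef hσ hρ _) hc, rtr_smul]
  rfl

lemma exists_tendsto_minimalQ {ρ σ : Matrix n n ℂ} (hρ : ρ.PosSemidef) (hσ : σ.PosSemidef) :
    ∃ L, Tendsto (fun α => minimalQ α ρ σ) (𝓝[>] 0) (𝓝 L) := by
  -- Scaling ρ to a contraction costs a factor c^α, which tends to 1.
  set c := 1 + ‖ρ‖
  have hc : 0 < c := by positivity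
  have hρ' : (c⁻¹ • ρ).PosSemidef := hρ.smul (inv_pos.2 hc).le
  have hn : ‖c⁻¹ • ρ‖ ≤ 1 := by
    rw [norm_smul, Real.norm_of_nonneg (inv_pos.2 hc).le, inv_mul_le_one₀ hc]
    linarith
  obtain ⟨L, hL⟩ := exists_tendsto_minimalQ_of_norm_le_one hρ' hσ hn
  have hcα : Tendsto (fun α : ℝ => c ^ α) (𝓝[>] 0) (𝓝 1) := by
    have := (Real.continuous_const_rpow hc.ne').tendsto 0
    rw [Real.rpow_zero] at this
    exact this.mono_left nhdsWithin_le_nhds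
  have := hcα.mul hL
  rw [one_mul] at this
  refine ⟨L, this.congr fun α => ?_⟩
  rw [← minimalQ_smul hρ' hσ hc.le, smul_smul, mul_inv_cancel₀ hc.ne', one_smul]

/-! ### The Petz quasi-entropy as a classical double sum, and the kernel condition -/

lemma rtr_conjDiag_mul_conjDiag (U V : Matrix n n ℂ) (f g : n → ℝ) :
    rtr (conjDiag U f * conjDiag V g)
      = ∑ i, ∑ j, Complex.normSq ((Uᴴ * V) i j) * (f i * g j) := by
  have e : trace (conjDiag U f * conjDiag V g)
      = trace (diagonal (fun i => (f i : ℂ)) * ((Uᴴ * V) * diagonal (fun i => (g i : ℂ))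
          * (Uᴴ * V)ᴴ)) := by
    rw [conjDiag, conjDiag, Matrix.mul_assoc, Matrix.mul_assoc, trace_mul_comm, conjTranspose_mul,
      conjTranspose_conjTranspose]
    simp only [Matrix.mul_assoc]
  rw [rtr, e]
  simp only [trace, diag_apply, diagonal_mul]
  rw [Complex.re_sum]
  refine Finset.sum_congr rfl fun i _ => ?_
  rw [Matrix.mul_apply, Finset.mul_sum, Complex.re_sum]
  refine Finset.sum_congr rfl fun j _ => ?_
  rw [mul_diagonal, conjTranspose_apply]
  have : ∀ (a b : ℝ) (z : ℂ), ((a : ℂ) * (z * b * star z)).re = Complex.normSq z * (a * b) := by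
    intro a b z
    rw [show (a : ℂ) * (z * b * star z) = ((a * b : ℝ) : ℂ) * (z * star z) by push_cast; ring]
    rw [Complex.star_def, Complex.mul_conj, ← Complex.ofReal_mul, Complex.ofReal_re, mul_comm]
  exact this _ _ _

/-- The projection onto the kernel. -/
def kerProj (A : Matrix n n ℂ) : Matrix n n ℂ :=
  cfc (fun x : ℝ => if x = 0 then 1 else 0) A

/-- With P the projection onto ker σ: if tr ρP = 0, the positive matrix PρP has trace zero and
vanishes, so ⟨v, ρv⟩ = 0 on ker σ, and positivity of ρ gives ρv = 0. -/
lemma dominates_iff {ρ σ : Matrix n n ℂ} (hρ : ρ.PosSemidef) (hσ : σ.PosSemidef) :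
    Dominates σ ρ ↔ rtr (ρ * kerProj σ) = 0 := by
  obtain ⟨V, h1, h2, h3, h4⟩ := exists_conjDiag hσ
  set q := hσ.isHermitian.eigenvalues
  have hK : kerProj σ = conjDiag V (fun i => if q i = 0 then 1 else 0) := by
    rw [h3, kerProj, cfc_conjDiag h1 h2]
  have hσK : σ * kerProj σ = 0 := by
    have : (fun i => q i * if q i = 0 then 1 else 0) = fun _ => (0 : ℝ) := by
      ext i
      by_cases h : q i = 0 <;> simp [h]
    rw [hK, h3, conjDiag_mul h1, this, conjDiag_const h2, zero_smul]
  have hKK : kerProj σ * kerProj σ = kerProj σ := by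
    rw [hK, conjDiag_mul h1]
    congr 1
    ext i
    by_cases h : q i = 0 <;> simp [h]
  have hKH : (kerProj σ)ᴴ = kerProj σ := by
    rw [hK]
    exact conjDiag_isHermitian _ _
  have hone : kerProj σ + conjDiag V (fun i => (q i)⁻¹) * σ = 1 := by
    have : (fun i => (if q i = 0 then 1 else 0) + (q i)⁻¹ * q i) = fun _ => (1 : ℝ) := by
      ext i
      by_cases h : q i = 0 <;> simp [h]
    rw [hK, h3, conjDiag_mul h1, conjDiag_add, this, conjDiag_const h2, one_smul]
  constructor
  · intro h
    have : ρ * kerProj σ = 0 := by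
      apply Matrix.mulVec_injective
      ext1 v
      rw [← mulVec_mulVec, h _ (by rw [mulVec_mulVec, hσK, zero_mulVec]), zero_mulVec]
    rw [this]
    simp [rtr]
  · intro h v hv
    have hP : (kerProj σ * ρ * kerProj σ).PosSemidef := by
      have := hρ.mul_mul_conjTranspose_same (kerProj σ)
      rwa [hKH] at this
    have hP0 : kerProj σ * ρ * kerProj σ = 0 := by
      apply rtr_eq_zero hP
      rw [Matrix.mul_assoc, rtr_mul_comm, Matrix.mul_assoc, hKK, h]
    have hKv : kerProj σ *ᵥ v = v := by
      have := congrArg (· *ᵥ v) hone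
      simpa [add_mulVec, ← mulVec_mulVec, hv] using this
    have h0 : star (kerProj σ *ᵥ v) ⬝ᵥ (ρ *ᵥ (kerProj σ *ᵥ v)) = 0 := by
      rw [star_mulVec, hKH, ← dotProduct_mulVec, mulVec_mulVec, mulVec_mulVec, hP0]
      simp
    rw [← hKv]
    exact (hρ.dotProduct_mulVec_zero_iff _).1 h0

/-- The Petz quasi-entropy extends to a differentiable function of the parameter. -/
lemma exists_differentiable_petzQ {ρ σ : Matrix n n ℂ} (hρ : ρ.PosSemidef) (hσ : σ.PosSemidef) :
    ∃ F : ℝ → ℝ, Differentiable ℝ F ∧ (∀ α, 0 ≤ F α) ∧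
      (∀ α, α ≠ 0 → α ≠ 1 → petzQ α ρ σ = F α) ∧ (Dominates σ ρ → F 1 = rtr ρ) ∧
      (¬ Dominates σ ρ → F 1 < rtr ρ) := by
  obtain ⟨U, u1, u2, u3, u4⟩ := exists_conjDiag hρ
  obtain ⟨V, v1, v2, v3, v4⟩ := exists_conjDiag hσ
  set p := hρ.isHermitian.eigenvalues
  set q := hσ.isHermitian.eigenvalues
  set w : n → n → ℝ := fun i j => Complex.normSq ((Uᴴ * V) i j)
  have hw : ∀ i j, 0 ≤ w i j := fun i j => Complex.normSq_nonneg _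
  have hker : rtr (ρ * kerProj σ) = ∑ i, ∑ j, w i j * (p i * if q j = 0 then 1 else 0) := by
    rw [v3, kerProj, cfc_conjDiag v1 v2]
    conv_lhs => rw [u3]
    exact rtr_conjDiag_mul_conjDiag _ _ _ _
  have htr : rtr ρ = ∑ i, ∑ j, w i j * (p i * 1) := by
    have := rtr_conjDiag_mul_conjDiag U V p fun _ => 1
    rwa [conjDiag_const v2, one_smul, Matrix.mul_one, ← u3] at this
  -- Discarding pairs with a zero eigenvalue makes every term differentiable in α. At α = 0 and α =
  -- 1 this can differ from `petzQ`, where 0 ^ 0 = 1 intervenes.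
  set F : ℝ → ℝ := fun α => ∑ i, ∑ j, w i j *
    if 0 < p i ∧ 0 < q j then p i ^ α * q j ^ (1 - α) else 0
  -- The deficit of `F 1` is the mass of ρ on ker σ, which detects domination.
  have hF1 : F 1 + rtr (ρ * kerProj σ) = rtr ρ := by
    rw [hker, htr, ← Finset.sum_add_distrib]
    refine Finset.sum_congr rfl fun i _ => ?_
    rw [← Finset.sum_add_distrib]
    refine Finset.sum_congr rfl fun j _ => ?_
    rcases (u4 i).eq_or_lt with hi | hi <;> rcases (v4 j).eq_or_lt with hj | hj
    · simp [p, ← hi]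
    · simp [p, ← hi]
    · simp [q, ← hj]
    · simp only [p, q, hi, hj, hj.ne', and_self, if_true, if_false]
      simp
  have hκ : 0 ≤ rtr (ρ * kerProj σ) := by
    rw [hker]
    refine Finset.sum_nonneg fun i _ => Finset.sum_nonneg fun j _ => mul_nonneg (hw i j) ?_
    exact mul_nonneg (u4 i) (by split_ifs <;> norm_num)
  refine ⟨F, ?_, fun α => ?_, fun α h0 h1 => ?_, fun h => ?_, fun h => ?_⟩
  · refine Differentiable.fun_sum fun i _ => Differentiable.fun_sum fun j _ => ?_
    refine Differentiable.const_mul ?_ _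
    by_cases h : 0 < p i ∧ 0 < q j
    · simp only [h, and_self, if_true]
      refine Differentiable.mul (fun α => ?_) fun α => ?_
      · exact (differentiableAt_const _).rpow differentiableAt_id h.1.ne'
      · exact (differentiableAt_const _).rpow ((differentiableAt_const 1).sub differentiableAt_id)
          h.2.ne'
    · simp only [h, if_false]
      exact differentiable_const _
  · refine Finset.sum_nonneg fun i _ => Finset.sum_nonneg fun j _ => mul_nonneg (hw i j) ?_
    split_ifs
    · exact mul_nonneg (Real.rpow_nonneg (u4 i) _) (Real.rpow_nonneg (v4 j) _)
    · exact le_rfl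
  · have : petzQ α ρ σ = ∑ i, ∑ j, w i j * (p i ^ α * q j ^ (1 - α)) := by
      rw [petzQ]
      conv_lhs => rw [u3, v3]
      rw [mpow_conjDiag u1 u2, mpow_conjDiag v1 v2]
      exact rtr_conjDiag_mul_conjDiag _ _ _ _
    rw [this]
    refine Finset.sum_congr rfl fun i _ => Finset.sum_congr rfl fun j _ => ?_
    rcases (u4 i).eq_or_lt with hi | hi <;> rcases (v4 j).eq_or_lt with hj | hj
    · simp [p, ← hi, Real.zero_rpow h0]
    · simp [p, ← hi, Real.zero_rpow h0]
    · simp [q, ← hj, Real.zero_rpow (sub_ne_zero.2 h1.symm)]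
    · simp only [p, q, hi, hj, and_self, if_true]
  · rw [(dominates_iff hρ hσ).1 h] at hF1
    linarith
  · have := hκ.lt_of_ne fun e => h ((dominates_iff hρ hσ).2 e.symm)
    linarith

lemma petzQ_nonneg {ρ σ : Matrix n n ℂ} (hρ : ρ.PosSemidef) (hσ : σ.PosSemidef) {α : ℝ}
    (h1 : α ≠ 1) : 0 ≤ petzQ α ρ σ := by
  rw [petzQ_eq_rtr_mpow hρ hσ h1]
  exact rtr_nonneg (mpow_posSemidef (conj_posSemidef hσ (mpow_posSemidef hρ _) _) _)

/-! ### Finite divergences and their common limit at 1 -/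

lemma rtr_pos {A : Matrix n n ℂ} (hA : A.PosSemidef) (h0 : A ≠ 0) : 0 < rtr A :=
  (rtr_nonneg hA).lt_of_ne fun e => h0 (rtr_eq_zero hA e.symm)

lemma pos_of_mul_rpow_mul_rpow_pos {a b c u v w x : ℝ} (ha : 0 ≤ a) (hb : 0 ≤ b) (hc : 0 ≤ c)
    (hu : u ≠ 0) (hv : v ≠ 0) (hw : w ≠ 0) (hx : 0 < x) (h : x ≤ a ^ u * b ^ v * c ^ w) :
    0 < a ∧ 0 < b ∧ 0 < c := by
  have h' := hx.trans_le h
  refine ⟨ha.lt_of_ne ?_, hb.lt_of_ne ?_, hc.lt_of_ne ?_⟩ <;> rintro rfl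
  · simp [Real.zero_rpow hu] at h'
  · simp [Real.zero_rpow hv] at h'
  · simp [Real.zero_rpow hw] at h'

lemma log_le_of_le_mul_rpow {a b c u v w x : ℝ} (ha : 0 < a) (hb : 0 < b) (hc : 0 < c)
    (hx : 0 < x) (h : x ≤ a ^ u * b ^ v * c ^ w) :
    Real.log x ≤ u * Real.log a + v * Real.log b + w * Real.log c := by
  have := Real.log_le_log hx h
  rwa [Real.log_mul (by positivity) (by positivity), Real.log_mul (by positivity) (by positivity),
    Real.log_rpow ha, Real.log_rpow hb, Real.log_rpow hc] at this

/-- The real value of a divergence with quasi-entropy `Q`, when this is positive. -/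
def divReal (t Q α : ℝ) : ℝ := Real.log (1 / t * Q) / (α - 1)

lemma log_one_div_mul {t Q : ℝ} (ht : 0 < t) (hQ : 0 < Q) :
    Real.log (1 / t * Q) = Real.log Q - Real.log t := by
  rw [one_div_mul_eq_div, Real.log_div hQ.ne' ht.ne']

lemma divReal_bounds {ρ σ : Matrix n n ℂ} (hρ : ρ.PosSemidef) (hρ0 : ρ ≠ 0) (hσ : σ.PosSemidef)
    {α : ℝ} (h0 : 0 < α) (h1 : α < 1) (hQ : 0 < petzQ α ρ σ) :
    0 < minimalQ α ρ σ ∧ 0 < rtr σ ∧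
    α * divReal (rtr ρ) (petzQ α ρ σ) α + (1 - α) * (Real.log (rtr ρ) - Real.log (rtr σ))
      ≤ divReal (rtr ρ) (minimalQ α ρ σ) α ∧
    divReal (rtr ρ) (minimalQ α ρ σ) α ≤ divReal (rtr ρ) (petzQ α ρ σ) α := by
  have hT := rtr_pos hρ hρ0
  have h1' : 0 < 1 - α := sub_pos.2 h1
  have hle := petzQ_le_minimalQ hρ hσ h0 h1
  have hle' := minimalQ_le_rpow hρ hσ h0 h1
  have hQ' := hQ.trans_le hle
  have hS := (pos_of_mul_rpow_mul_rpow_pos (rtr_nonneg hσ) hQ.le hT.le (by positivity) h0.ne'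
    (by positivity) hQ' hle').1
  have hlog := log_le_of_le_mul_rpow hS hQ hT hQ' hle'
  have hlog' := Real.log_le_log hQ hle
  refine ⟨hQ', hS, ?_, ?_⟩
  · rw [divReal, divReal, log_one_div_mul hT hQ, log_one_div_mul hT hQ',
      ← sub_nonneg]
    -- The gap in the lower bound is the logarithmic gap in the Hölder bound, divided by 1 - α.
    have e : (Real.log (minimalQ α ρ σ) - Real.log (rtr ρ)) / (α - 1)
        - (α * ((Real.log (petzQ α ρ σ) - Real.log (rtr ρ)) / (α - 1))
          + (1 - α) * (Real.log (rtr ρ) - Real.log (rtr σ)))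
        = ((1 - α) ^ 2 * Real.log (rtr σ) + α * Real.log (petzQ α ρ σ)
          + α * (1 - α) * Real.log (rtr ρ) - Real.log (minimalQ α ρ σ)) / (1 - α) := by
      have : α - 1 ≠ 0 := by linarith
      have e2 : α - 1 = -(1 - α) := by ring
      rw [e2, div_neg, div_neg]
      field_simp
      ring
    rw [e]
    exact div_nonneg (by linarith) h1'.le
  · rw [divReal, divReal, log_one_div_mul hT hQ, log_one_div_mul hT hQ']
    exact div_le_div_of_nonpos_of_le (by linarith) (by linarith)

lemma divReal_bounds_of_one_lt {ρ σ : Matrix n n ℂ} (hρ : ρ.PosSemidef) (hρ0 : ρ ≠ 0)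
    (hσ : σ.PosSemidef) {α : ℝ} (h1 : 1 < α) (h2 : α < 2) (hQ : 0 < petzQ α ρ σ) :
    0 < minimalQ α ρ σ ∧
    α * divReal (rtr ρ) (petzQ α ρ σ) α - (α - 1) * Real.log (rtr (mpow σ (-1)))
        - (2 - α) * Real.log (rtr (mpow ρ (α / (2 - α)))) + Real.log (rtr ρ)
      ≤ divReal (rtr ρ) (minimalQ α ρ σ) α ∧
    divReal (rtr ρ) (minimalQ α ρ σ) α ≤ divReal (rtr ρ) (petzQ α ρ σ) α := by
  have hT := rtr_pos hρ hρ0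
  have h0 : 0 < α := by linarith
  have h1' : 0 < α - 1 := sub_pos.2 h1
  have h2' : 0 < 2 - α := sub_pos.2 h2
  have hle := minimalQ_le_petzQ hρ hσ h1
  have hle' := petzQ_le_rpow hρ hσ h1 h2
  obtain ⟨hR, hQ', hW⟩ := pos_of_mul_rpow_mul_rpow_pos (rtr_nonneg (mpow_posSemidef hσ _))
    (minimalQ_nonneg hρ hσ α) (rtr_nonneg (mpow_posSemidef hρ _)) (by positivity) (by positivity)
    (by positivity) hQ hle'
  have hlog := log_le_of_le_mul_rpow hR hQ' hW hQ hle'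
  have hlog' := Real.log_le_log hQ' hle
  refine ⟨hQ', ?_, ?_⟩
  · rw [divReal, divReal, log_one_div_mul hT hQ, log_one_div_mul hT hQ', ← sub_nonneg]
    set a := Real.log (petzQ α ρ σ)
    set b := Real.log (minimalQ α ρ σ)
    set r := Real.log (rtr (mpow σ (-1)))
    set k := Real.log (rtr (mpow ρ (α / (2 - α))))
    set t := Real.log (rtr ρ)
    have e : (b - t) / (α - 1) - (α * ((a - t) / (α - 1)) - (α - 1) * r - (2 - α) * k + t)
        = α * ((α - 1) ^ 2 / α * r + 1 / α * b + (α - 1) * (2 - α) / α * k - a) / (α - 1) := by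
      field_simp
      ring
    rw [e]
    exact div_nonneg (mul_nonneg h0.le (by linarith)) h1'.le
  · rw [divReal, divReal, log_one_div_mul hT hQ, log_one_div_mul hT hQ']
    exact div_le_div_of_nonneg_right (by linarith) h1'.le

lemma tendsto_rtr_mpow {ρ : Matrix n n ℂ} (hρ : ρ.PosSemidef) {f : ℝ → ℝ} {l : Filter ℝ}
    (hf : Tendsto f l (𝓝 1)) : Tendsto (fun α => rtr (mpow ρ (f α))) l (𝓝 (rtr ρ)) := by
  have e : rtr ρ = ∑ i, hρ.isHermitian.eigenvalues i ^ (1 : ℝ) := by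
    rw [← rtr_mpow hρ, mpow_one hρ]
  simp only [rtr_mpow hρ]
  rw [e]
  refine tendsto_finsetSum _ fun i _ => ?_
  exact (Real.continuousAt_const_rpow' one_ne_zero).tendsto.comp hf

/-- In the dominated case both divergences have the same finite limit at `1`. -/
lemma exists_tendsto_divReal {ρ σ : Matrix n n ℂ} (hρ : ρ.PosSemidef) (hρ0 : ρ ≠ 0)
    (hσ : σ.PosSemidef) (hd : Dominates σ ρ) :
    ∃ S, (∀ᶠ α in 𝓝[≠] (1 : ℝ), 0 < petzQ α ρ σ ∧ 0 < minimalQ α ρ σ) ∧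
      Tendsto (fun α => divReal (rtr ρ) (petzQ α ρ σ) α) (𝓝[≠] 1) (𝓝 S) ∧
      Tendsto (fun α => divReal (rtr ρ) (minimalQ α ρ σ) α) (𝓝[≠] 1) (𝓝 S) := by
  obtain ⟨F, hF, hF0, hFQ, hF1, -⟩ := exists_differentiable_petzQ hρ hσ
  have hT := rtr_pos hρ hρ0
  have hF1 := hF1 hd
  have hne0 : ∀ᶠ α in 𝓝[≠] (1 : ℝ), α ≠ 0 :=
    eventually_nhdsWithin_of_eventually_nhds (eventually_ne_nhds one_ne_zero)
  have hpQ : ∀ᶠ α in 𝓝[≠] (1 : ℝ), petzQ α ρ σ = F α := by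
    filter_upwards [hne0, self_mem_nhdsWithin] with α h0 h1 using hFQ α h0 h1
  have hpos : ∀ᶠ α in 𝓝[≠] (1 : ℝ), 0 < petzQ α ρ σ := by
    have : ∀ᶠ α in 𝓝 (1 : ℝ), 0 < F α :=
      (hF.continuous.tendsto 1).eventually (lt_mem_nhds (by rw [hF1]; exact hT))
    filter_upwards [hpQ, eventually_nhdsWithin_of_eventually_nhds this] with α h h'
    rwa [h]
  -- As F 1 = tr ρ, this logarithm vanishes at 1, and the Petz divergence is its difference
  -- quotient.
  have hder : DifferentiableAt ℝ (fun α => Real.log (1 / rtr ρ * F α)) 1 := by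
    refine ((hF 1).const_mul _).log ?_
    rw [hF1, one_div_mul_cancel hT.ne']
    exact one_ne_zero
  set S := deriv (fun α => Real.log (1 / rtr ρ * F α)) 1
  have hpetz : Tendsto (fun α => divReal (rtr ρ) (petzQ α ρ σ) α) (𝓝[≠] 1) (𝓝 S) := by
    refine (hasDerivAt_iff_tendsto_slope.1 hder.hasDerivAt).congr' ?_
    filter_upwards [hpQ] with α h
    rw [slope_def_field, divReal, h, hF1, one_div_mul_cancel hT.ne', Real.log_one, sub_zero]
  have hα : Tendsto (fun α : ℝ => α) (𝓝 1) (𝓝 1) := tendsto_id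
  have hle : 𝓝[<] (1 : ℝ) ≤ 𝓝[≠] 1 := nhdsWithin_mono _ fun x hx => ne_of_lt hx
  have hge : 𝓝[>] (1 : ℝ) ≤ 𝓝[≠] 1 := nhdsWithin_mono _ fun x hx => ne_of_gt hx
  have ev1 : ∀ᶠ α in 𝓝[<] (1 : ℝ), 0 < α ∧ α < 1 ∧ 0 < petzQ α ρ σ := by
    filter_upwards [Ioo_mem_nhdsLT (zero_lt_one (α := ℝ)), hle hpos] with α h h'
      using ⟨h.1, h.2, h'⟩
  have ev2 : ∀ᶠ α in 𝓝[>] (1 : ℝ), 1 < α ∧ α < 2 ∧ 0 < petzQ α ρ σ := by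
    filter_upwards [Ioo_mem_nhdsGT (one_lt_two (α := ℝ)), hge hpos] with α h h'
      using ⟨h.1, h.2, h'⟩
  refine ⟨S, ?_, hpetz, ?_⟩
  · rw [← nhdsLT_sup_nhdsGT, eventually_sup]
    constructor
    · filter_upwards [ev1] with α h
      exact ⟨h.2.2, (divReal_bounds hρ hρ0 hσ h.1 h.2.1 h.2.2).1⟩
    · filter_upwards [ev2] with α h
      exact ⟨h.2.2, (divReal_bounds_of_one_lt hρ hρ0 hσ h.1 h.2.1 h.2.2).1⟩
  · rw [← nhdsLT_sup_nhdsGT, tendsto_sup]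
    constructor
    · have l2 := hpetz.mono_left hle
      have hα' := hα.mono_left (nhdsWithin_le_nhds (s := Set.Iio (1 : ℝ)))
      have l1 := (hα'.mul l2).add (((tendsto_const_nhds (x := (1 : ℝ))).sub hα').mul
        (tendsto_const_nhds (x := Real.log (rtr ρ) - Real.log (rtr σ))))
      rw [one_mul, sub_self, zero_mul, add_zero] at l1
      refine tendsto_of_tendsto_of_tendsto_of_le_of_le' l1 l2 ?_ ?_
      · filter_upwards [ev1] with α h
        exact (divReal_bounds hρ hρ0 hσ h.1 h.2.1 h.2.2).2.2.1
      · filter_upwards [ev1] with α h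
        exact (divReal_bounds hρ hρ0 hσ h.1 h.2.1 h.2.2).2.2.2
    · have l2 := hpetz.mono_left hge
      have hα' := hα.mono_left (nhdsWithin_le_nhds (s := Set.Ioi (1 : ℝ)))
      have h2α : Tendsto (fun α : ℝ => 2 - α) (𝓝[>] 1) (𝓝 1) := by
        have := (tendsto_const_nhds (x := (2 : ℝ))).sub hα'
        norm_num at this
        exact this
      -- The trace of ρ^(α/(2-α)) tends to tr ρ, so its logarithm cancels the last term of the lower
      -- bound.
      have hexp : Tendsto (fun α : ℝ => α / (2 - α)) (𝓝[>] 1) (𝓝 1) := by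
        have := hα'.div h2α one_ne_zero
        rw [div_one] at this
        exact this
      have hlog := (tendsto_rtr_mpow hρ hexp).log hT.ne'
      have l1 := (((hα'.mul l2).sub ((hα'.sub (tendsto_const_nhds (x := (1 : ℝ)))).mul
        (tendsto_const_nhds (x := Real.log (rtr (mpow σ (-1))))))).sub (h2α.mul hlog)).add
        (tendsto_const_nhds (x := Real.log (rtr ρ)))
      have e : 1 * S - (1 - 1) * Real.log (rtr (mpow σ (-1))) - 1 * Real.log (rtr ρ)
          + Real.log (rtr ρ) = S := by ring
      rw [e] at l1
      refine tendsto_of_tendsto_of_tendsto_of_le_of_le' l1 l2 ?_ ?_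
      · filter_upwards [ev2] with α h
        exact (divReal_bounds_of_one_lt hρ hρ0 hσ h.1 h.2.1 h.2.2).2.1
      · filter_upwards [ev2] with α h
        exact (divReal_bounds_of_one_lt hρ hρ0 hσ h.1 h.2.1 h.2.2).2.2

/-! ### Extended real values and the endpoints -/

lemma continuous_elog : Continuous elog :=
  ENNReal.continuous_log.comp ENNReal.continuous_ofReal

lemma elog_of_pos {x : ℝ} (hx : 0 < x) : elog x = (Real.log x : ℝ) :=
  ENNReal.log_ofReal_of_pos hx

lemma elog_zero : elog 0 = ⊥ := by simp [elog]

lemma elog_one : elog 1 = 0 := by simp [elog]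

lemma elog_mono {x y : ℝ} (h : x ≤ y) : elog x ≤ elog y :=
  ENNReal.log_monotone (ENNReal.ofReal_le_ofReal h)

lemma coe_mul_elog_of_pos {t Q α : ℝ} (ht : 0 < t) (hQ : 0 < Q) :
    ((1 / (α - 1) : ℝ) : EReal) * elog (1 / t * Q) = (divReal t Q α : ℝ) := by
  rw [elog_of_pos (by positivity), ← EReal.coe_mul, divReal, one_div_mul_eq_div]

lemma coe_mul_elog_zero {t α : ℝ} (hα : α < 1) :
    ((1 / (α - 1) : ℝ) : EReal) * elog (1 / t * 0) = ⊤ := by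
  rw [mul_zero, elog_zero, EReal.coe_mul_bot_of_neg (one_div_neg.2 (sub_neg.2 hα))]

lemma petzAux_of_lt {ρ σ : Matrix n n ℂ} {α : ℝ} (h : α < 1) :
    petzAux ρ σ α = ((1 / (α - 1) : ℝ) : EReal) * elog (1 / rtr ρ * petzQ α ρ σ) :=
  if_pos (Or.inr h)

lemma minimalAux_of_lt {ρ σ : Matrix n n ℂ} {α : ℝ} (h : α < 1) :
    minimalAux ρ σ α = ((1 / (α - 1) : ℝ) : EReal) * elog (1 / rtr ρ * minimalQ α ρ σ) :=
  if_pos (Or.inr h)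

lemma tendsto_coe_mul_elog_zero {t : ℝ} {Q : ℝ → ℝ} {L : ℝ} (hQ : Tendsto Q (𝓝[>] 0) (𝓝 L)) :
    Tendsto (fun α : ℝ => ((1 / (α - 1) : ℝ) : EReal) * elog (1 / t * Q α)) (𝓝[>] 0)
      (𝓝 (((-1 : ℝ) : EReal) * elog (1 / t * L))) := by
  have h1 : Tendsto (fun α : ℝ => 1 / (α - 1)) (𝓝[>] 0) (𝓝 (-1)) := by
    have : ContinuousAt (fun α : ℝ => 1 / (α - 1)) 0 :=
      continuousAt_const.div (continuousAt_id.sub continuousAt_const) (by norm_num)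
    have h := this.tendsto
    norm_num at h
    simpa using h.mono_left nhdsWithin_le_nhds
  have h2 := (continuous_elog.tendsto (1 / t * L)).comp (hQ.const_mul (1 / t))
  have h3 : ((-1 : ℝ) : EReal) ≠ 0 := by norm_num
  have hc := EReal.continuousAt_mul (p := (((-1 : ℝ) : EReal), elog (1 / t * L))) (Or.inl h3)
    (Or.inl h3) (Or.inl (EReal.coe_ne_bot _)) (Or.inl (EReal.coe_ne_top _))
  exact hc.tendsto.comp ((EReal.tendsto_coe.2 h1).prodMk_nhds h2)

/-- The strict inequality L < t makes the limiting logarithm negative, possibly -∞. Multiplication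
is continuous there against -∞, and the product is +∞. -/
lemma tendsto_coe_mul_elog_one {t : ℝ} (ht : 0 < t) {Q : ℝ → ℝ} {L : ℝ} (hL : L < t)
    (hQ : Tendsto Q (𝓝[<] 1) (𝓝 L)) :
    Tendsto (fun α : ℝ => ((1 / (α - 1) : ℝ) : EReal) * elog (1 / t * Q α)) (𝓝[<] 1) (𝓝 ⊤) := by
  have h1 : Tendsto (fun α : ℝ => 1 / (α - 1)) (𝓝[<] 1) atBot := by
    have h : Tendsto (fun α : ℝ => α - 1) (𝓝[<] 1) (𝓝[<] 0) := by
      refine tendsto_nhdsWithin_iff.2 ⟨?_, ?_⟩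
      · have : Tendsto (fun α : ℝ => α - 1) (𝓝 1) (𝓝 (1 - 1)) :=
          tendsto_id.sub tendsto_const_nhds
        rw [sub_self] at this
        exact this.mono_left nhdsWithin_le_nhds
      · filter_upwards [self_mem_nhdsWithin] with α h using sub_neg.2 (Set.mem_Iio.1 h)
    simpa [Function.comp_def] using tendsto_inv_nhdsLT_zero.comp h
  have h2 := (continuous_elog.tendsto (1 / t * L)).comp (hQ.const_mul (1 / t))
  have h3 : elog (1 / t * L) < 0 := by
    rw [elog, ENNReal.log_lt_zero_iff, ENNReal.ofReal_lt_one, one_div_mul_eq_div, div_lt_one ht]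
    exact hL
  have hc := EReal.continuousAt_mul (p := ((⊥ : EReal), elog (1 / t * L)))
    (Or.inl EReal.bot_ne_zero) (Or.inl EReal.bot_ne_zero) (Or.inr h3.ne) (Or.inr h3.ne)
  have := hc.tendsto.comp ((EReal.tendsto_coe_atBot.comp h1).prodMk_nhds h2)
  rw [EReal.bot_mul_of_neg h3] at this
  exact this

/-- The two-sided bound in the open interval, together with a lower bound by the traces. -/
lemma minimalAux_bounds {ρ σ : Matrix n n ℂ} (hρ : ρ.PosSemidef) (hρ0 : ρ ≠ 0)
    (hσ : σ.PosSemidef) {α : ℝ} (h0 : 0 < α) (h1 : α < 1) :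
    (α : EReal) * petzAux ρ σ α + ((1 - α : ℝ) : EReal) * (elog (rtr ρ) - elog (rtr σ))
      ≤ minimalAux ρ σ α ∧ minimalAux ρ σ α ≤ petzAux ρ σ α ∧
    elog (rtr ρ) - elog (rtr σ) ≤ minimalAux ρ σ α := by
  have hT := rtr_pos hρ hρ0
  rw [petzAux_of_lt h1, minimalAux_of_lt h1]
  -- If `petzQ` vanishes, the Hölder bound forces `minimalQ` to vanish too, and both divergences are
  -- +∞.
  rcases (petzQ_nonneg hρ hσ h1.ne).eq_or_lt with hQ | hQ
  · have hQ' : minimalQ α ρ σ = 0 := by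
      refine le_antisymm ?_ (minimalQ_nonneg hρ hσ α)
      have := minimalQ_le_rpow hρ hσ h0 h1
      rwa [← hQ, Real.zero_rpow h0.ne', mul_zero, zero_mul] at this
    rw [hQ', ← hQ, coe_mul_elog_zero h1]
    exact ⟨le_top, le_rfl, le_top⟩
  · obtain ⟨hQ', hS, hl, hu⟩ := divReal_bounds hρ hρ0 hσ h0 h1 hQ
    rw [coe_mul_elog_of_pos hT hQ, coe_mul_elog_of_pos hT hQ', elog_of_pos hT, elog_of_pos hS]
    refine ⟨by exact_mod_cast hl, by exact_mod_cast hu, ?_⟩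
    have h1' : 0 < 1 - α := sub_pos.2 h1
    -- Let a be the difference of logarithms. From αD̄ + (1-α)a ≤ D̃ ≤ D̄ follows a ≤ D̄, hence a ≤
    -- D̃.
    have h2 : Real.log (rtr ρ) - Real.log (rtr σ) ≤ divReal (rtr ρ) (petzQ α ρ σ) α := by
      refine le_of_mul_le_mul_left ?_ h1'
      nlinarith
    have h3 : Real.log (rtr ρ) - Real.log (rtr σ) ≤ divReal (rtr ρ) (minimalQ α ρ σ) α := by
      nlinarith [mul_le_mul_of_nonneg_left h2 h0.le]
    exact_mod_cast h3

lemma exists_tendsto_petzAux_zero {ρ σ : Matrix n n ℂ} (hρ : ρ.PosSemidef) (hσ : σ.PosSemidef) :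
    ∃ l, Tendsto (petzAux ρ σ) (𝓝[>] 0) (𝓝 l) := by
  obtain ⟨F, hF, -, hFQ, -⟩ := exists_differentiable_petzQ hρ hσ
  refine ⟨_, (tendsto_coe_mul_elog_zero (t := rtr ρ)
    ((hF.continuous.tendsto 0).mono_left nhdsWithin_le_nhds)).congr' ?_⟩
  filter_upwards [Ioo_mem_nhdsGT (zero_lt_one (α := ℝ))] with α hα
  rw [petzAux_of_lt hα.2, hFQ α hα.1.ne' hα.2.ne]

lemma exists_tendsto_minimalAux_zero {ρ σ : Matrix n n ℂ} (hρ : ρ.PosSemidef)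
    (hσ : σ.PosSemidef) : ∃ l, Tendsto (minimalAux ρ σ) (𝓝[>] 0) (𝓝 l) := by
  obtain ⟨L, hL⟩ := exists_tendsto_minimalQ hρ hσ
  refine ⟨_, (tendsto_coe_mul_elog_zero (t := rtr ρ) hL).congr' ?_⟩
  filter_upwards [Ioo_mem_nhdsGT (zero_lt_one (α := ℝ))] with α hα
  rw [minimalAux_of_lt hα.2]

lemma exists_tendsto_aux_one {ρ σ : Matrix n n ℂ} (hρ : ρ.PosSemidef) (hρ0 : ρ ≠ 0)
    (hσ : σ.PosSemidef) :
    ∃ l, Tendsto (petzAux ρ σ) (𝓝[≠] 1) (𝓝 l) ∧ Tendsto (minimalAux ρ σ) (𝓝[≠] 1) (𝓝 l) := by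
  have hT := rtr_pos hρ hρ0
  by_cases hd : Dominates σ ρ
  · obtain ⟨S, hpos, h1, h2⟩ := exists_tendsto_divReal hρ hρ0 hσ hd
    refine ⟨(S : EReal), (EReal.tendsto_coe.2 h1).congr' ?_, (EReal.tendsto_coe.2 h2).congr' ?_⟩
    · filter_upwards [hpos] with α hα
      rw [petzAux, if_pos (Or.inl hd), coe_mul_elog_of_pos hT hα.1]
    · filter_upwards [hpos] with α hα
      rw [minimalAux, if_pos (Or.inl hd), coe_mul_elog_of_pos hT hα.2]
  · obtain ⟨F, hF, hF0, hFQ, -, hF1⟩ := exists_differentiable_petzQ hρ hσ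
    have hF1 := hF1 hd
    have ev : ∀ᶠ α in 𝓝[<] (1 : ℝ), 0 < α ∧ α < 1 := by
      filter_upwards [Ioo_mem_nhdsLT (zero_lt_one (α := ℝ))] with α h using h
    have hF' : Tendsto F (𝓝[<] 1) (𝓝 (F 1)) :=
      (hF.continuous.tendsto 1).mono_left nhdsWithin_le_nhds
    have right : ∀ α ∈ Set.Ioi (1 : ℝ), ¬ (Dominates σ ρ ∨ α < 1) := fun α hα h =>
      h.elim hd fun h' => (lt_asymm h' hα).elim
    refine ⟨⊤, ?_, ?_⟩ <;> rw [← nhdsLT_sup_nhdsGT, tendsto_sup] <;> constructor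
    · refine (tendsto_coe_mul_elog_one hT hF1 hF').congr' ?_
      filter_upwards [ev] with α hα
      rw [petzAux_of_lt hα.2, hFQ α hα.1.ne' hα.2.ne]
    · refine tendsto_const_nhds.congr' ?_
      filter_upwards [self_mem_nhdsWithin] with α hα
      rw [petzAux, if_neg (right α hα)]
    · have hs := rtr_nonneg hσ
      have hs1 : 0 < 1 + rtr σ := by linarith
      -- The Hölder bound, with 1 + tr σ for tr σ so that the base stays positive as its exponent
      -- tends to 0. It tends to F 1 < tr ρ, which forces the smaller `minimalQ` to give an infinite
      -- limit as well.
      set G : ℝ → ℝ := fun α => (1 + rtr σ) ^ ((1 - α) ^ 2) * F α ^ α * rtr ρ ^ (α * (1 - α))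
      have hα : Tendsto (fun α : ℝ => α) (𝓝[<] 1) (𝓝 1) :=
        tendsto_nhdsWithin_of_tendsto_nhds tendsto_id
      have hα' : Tendsto (fun α : ℝ => 1 - α) (𝓝[<] 1) (𝓝 0) := by
        simpa using (tendsto_const_nhds (x := (1 : ℝ))).sub hα
      have hG : Tendsto G (𝓝[<] 1) (𝓝 (F 1)) := by
        have g1 := (tendsto_const_nhds (x := 1 + rtr σ)).rpow (hα'.pow 2) (Or.inl hs1.ne')
        have g2 := hF'.rpow hα (Or.inr one_pos)
        have g3 := (tendsto_const_nhds (x := rtr ρ)).rpow (hα.mul hα') (Or.inl hT.ne')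
        simpa using (g1.mul g2).mul g3
      refine tendsto_of_tendsto_of_tendsto_of_le_of_le' (tendsto_coe_mul_elog_one hT hF1 hG)
        tendsto_const_nhds ?_ (Eventually.of_forall fun _ => le_top)
      filter_upwards [ev] with α hα
      rw [minimalAux_of_lt hα.2, mul_comm, mul_comm ((1 / (α - 1) : ℝ) : EReal)]
      refine EReal.mul_le_mul_of_nonpos_right (elog_mono ?_) ?_
      · refine mul_le_mul_of_nonneg_left ((minimalQ_le_rpow hρ hσ hα.1 hα.2).trans ?_)
          (by positivity)
        rw [hFQ α hα.1.ne' hα.2.ne]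
        have := hF0 α
        have : rtr σ ^ ((1 - α) ^ 2) ≤ (1 + rtr σ) ^ ((1 - α) ^ 2) :=
          Real.rpow_le_rpow hs (by linarith) (sq_nonneg _)
        simp only [G]
        gcongr
      · exact_mod_cast (one_div_neg.2 (sub_neg.2 hα.2)).le
    · refine tendsto_const_nhds.congr' ?_
      filter_upwards [self_mem_nhdsWithin] with α hα
      rw [minimalAux, if_neg (right α hα)]

lemma minimalDiv_bounds {ρ σ : Matrix n n ℂ} (hρ : ρ.PosSemidef) (hρ0 : ρ ≠ 0)
    (hσ : σ.PosSemidef) {α : ℝ} (hα : α ∈ Set.Icc (0 : ℝ) 1) :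
    (α : EReal) * petzDiv α ρ σ + ((1 - α : ℝ) : EReal) * (elog (rtr ρ) - elog (rtr σ))
      ≤ minimalDiv α ρ σ ∧ minimalDiv α ρ σ ≤ petzDiv α ρ σ := by
  rcases hα.1.eq_or_lt with rfl | h0
  · obtain ⟨l, hl⟩ := exists_tendsto_petzAux_zero hρ hσ
    obtain ⟨m, hm⟩ := exists_tendsto_minimalAux_zero hρ hσ
    rw [petzDiv, minimalDiv, if_pos rfl, if_pos rfl, hl.limUnder_eq, hm.limUnder_eq]
    have ev : ∀ᶠ α in 𝓝[>] (0 : ℝ), 0 < α ∧ α < 1 := by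
      filter_upwards [Ioo_mem_nhdsGT (zero_lt_one (α := ℝ))] with α h using h
    constructor
    -- The Petz term is dropped even when infinite, as 0 · ∞ = 0. A limit of the two-sided bound
    -- could not give this, hence the separate lower bound by the traces.
    · rw [EReal.coe_zero, zero_mul, zero_add, sub_zero, EReal.coe_one, one_mul]
      refine ge_of_tendsto hm ?_
      filter_upwards [ev] with α h using (minimalAux_bounds hρ hρ0 hσ h.1 h.2).2.2
    · refine le_of_tendsto_of_tendsto hm hl ?_
      filter_upwards [ev] with α h using (minimalAux_bounds hρ hρ0 hσ h.1 h.2).2.1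
  rcases hα.2.eq_or_lt with rfl | h1
  · obtain ⟨l, hl, hm⟩ := exists_tendsto_aux_one hρ hρ0 hσ
    rw [petzDiv, minimalDiv, if_neg one_ne_zero, if_neg one_ne_zero, if_pos rfl, if_pos rfl,
      hl.limUnder_eq, hm.limUnder_eq, sub_self, EReal.coe_zero, zero_mul, add_zero, EReal.coe_one,
      one_mul]
    exact ⟨le_rfl, le_rfl⟩
  · have h := minimalAux_bounds hρ hρ0 hσ h0 h1
    rw [petzDiv, minimalDiv, if_neg h0.ne', if_neg h0.ne', if_neg h1.ne, if_neg h1.ne]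
    exact ⟨h.1, h.2.1⟩

end QDiv

end

theorem corollary2 {n : Type*} [Fintype n] [DecidableEq n] (ρ σ : Matrix n n ℂ)
    (hρ : ρ.PosSemidef) (hρ0 : ρ ≠ 0) (hσ : σ.PosSemidef) :
    -- the limits that define the divergences at the endpoints exist
    (Tendsto (QDiv.petzAux ρ σ) (𝓝[>] (0 : ℝ)) (𝓝 (QDiv.petzDiv 0 ρ σ)) ∧
      Tendsto (QDiv.petzAux ρ σ) (𝓝[≠] (1 : ℝ)) (𝓝 (QDiv.petzDiv 1 ρ σ)) ∧
      Tendsto (QDiv.minimalAux ρ σ) (𝓝[>] (0 : ℝ)) (𝓝 (QDiv.minimalDiv 0 ρ σ)) ∧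
      Tendsto (QDiv.minimalAux ρ σ) (𝓝[≠] (1 : ℝ)) (𝓝 (QDiv.minimalDiv 1 ρ σ))) ∧
    -- the two-sided bound, for all `α ∈ [0, 1]`
    (∀ α : ℝ, α ∈ Set.Icc (0 : ℝ) 1 →
      (α : EReal) * QDiv.petzDiv α ρ σ
          + ((1 - α : ℝ) : EReal) * (QDiv.elog (QDiv.rtr ρ) - QDiv.elog (QDiv.rtr σ))
        ≤ QDiv.minimalDiv α ρ σ ∧
      QDiv.minimalDiv α ρ σ ≤ QDiv.petzDiv α ρ σ) ∧
    -- the case of density operators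
    (ρ.trace = 1 → σ.trace = 1 → ∀ α : ℝ, α ∈ Set.Icc (0 : ℝ) 1 →
      (α : EReal) * QDiv.petzDiv α ρ σ ≤ QDiv.minimalDiv α ρ σ ∧
      QDiv.minimalDiv α ρ σ ≤ QDiv.petzDiv α ρ σ) := by
  refine ⟨⟨?_, ?_, ?_, ?_⟩, fun α hα => QDiv.minimalDiv_bounds hρ hρ0 hσ hα,
    fun h1 h2 α hα => ?_⟩
  · obtain ⟨l, hl⟩ := QDiv.exists_tendsto_petzAux_zero hρ hσ
    rwa [QDiv.petzDiv, if_pos rfl, hl.limUnder_eq]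
  · obtain ⟨l, hl, -⟩ := QDiv.exists_tendsto_aux_one hρ hρ0 hσ
    rwa [QDiv.petzDiv, if_neg one_ne_zero, if_pos rfl, hl.limUnder_eq]
  · obtain ⟨l, hl⟩ := QDiv.exists_tendsto_minimalAux_zero hρ hσ
    rwa [QDiv.minimalDiv, if_pos rfl, hl.limUnder_eq]
  · obtain ⟨l, -, hl⟩ := QDiv.exists_tendsto_aux_one hρ hρ0 hσ
    rwa [QDiv.minimalDiv, if_neg one_ne_zero, if_pos rfl, hl.limUnder_eq]
  · have h := QDiv.minimalDiv_bounds hρ hρ0 hσ hα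
    have e1 : QDiv.rtr ρ = 1 := by rw [QDiv.rtr, h1, Complex.one_re]
    have e2 : QDiv.rtr σ = 1 := by rw [QDiv.rtr, h2, Complex.one_re]
    rw [e1, e2, QDiv.elog_one, sub_zero, mul_zero, add_zero] at h
    exact h
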